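/- A binary form of degree $d$ is a homogeneous polynomial of degree $d$ in $\mathbb C[x,y]$. Two forms $f,g$ are called similar if $g(x,y)=f(\alpha x+\beta y,\gamma x+\delta y)$ for some $\alpha,\beta,\gamma,\delta\in\mathbb C$ with $\alpha\delta-\beta\gamma\neq 0$. For a binary sextic form $p$, let $N(p)$ be the number of unordered pairs $\{f^3,g^3\}$ such that $f,g$ are non-proportional (i.e. linearly independent) binary quadratic forms with $p=f^3+g^3$. For $t\in\mathbb C$ let $B_t(x,y)=x^6+t\,x^3y^3+y^6$. Theorem. A binary sextic form $p$ has $N(p)=3$ if and only if $p$ is similar to $B_t$ for some $t\in\mathbb C\setminus\{0,\,2,\,-2,\,5\sqrt{-2},\,-5\sqrt{-2}\}$. For the excluded values, $N(B_2)=N(B_{-2})=0$, $N(B_0)=4$ and $N(B_{5\sqrt{-2}})=N(B_{-5\sqrt{-2}})=6$. -/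

import Mathlib

namespace TwoCubes

open MvPolynomial

/-- Polynomials in two variables `x = X 0`, `y = X 1` over `ℂ`; a binary form of degree `d` is a
`p : Poly` with `p.IsHomogeneous d`. -/
abbrev Poly : Type := MvPolynomial (Fin 2) ℂ

/-- The substitution `(f ∘ M)(x, y) = f (α x + β y, γ x + δ y)` for `M = !![α, β; γ, δ]`. -/
noncomputable def comp (f : Poly) (M : Matrix (Fin 2) (Fin 2) ℂ) : Poly :=
  aeval (fun i : Fin 2 => C (M i 0) * X 0 + C (M i 1) * X 1 : Fin 2 → Poly) f

/-- `f` and `g` are similar: `g = f ∘ M` for an invertible linear change `M`. -/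
def Similar (f g : Poly) : Prop :=
  ∃ M : Matrix (Fin 2) (Fin 2) ℂ, M.det ≠ 0 ∧ g = comp f M

/-- The representations of `p` as a sum of two cubes of distinct (that is, non-proportional) binary
quadratic forms. A representation is the unordered pair `{f ^ 3, g ^ 3}`, so that neither the order
of the summands nor cube roots of unity multiplying `f` and `g` matter. -/
def representations (p : Poly) : Set (Sym2 Poly) :=
  {s | ∃ f g : Poly, f.IsHomogeneous 2 ∧ g.IsHomogeneous 2 ∧ LinearIndependent ℂ ![f, g] ∧
    f ^ 3 + g ^ 3 = p ∧ s = s(f ^ 3, g ^ 3)}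

/-- `N p`: the number (possibly infinite, a priori) of representations of `p` as a sum of two cubes
of quadratic forms. -/
noncomputable def N (p : Poly) : ℕ∞ := (representations p).encard

/-- The form `B_t = x ^ 6 + t x ^ 3 y ^ 3 + y ^ 6`. -/
noncomputable def B (t : ℂ) : Poly :=
  X 0 ^ 6 + C t * X 0 ^ 3 * X 1 ^ 3 + X 1 ^ 6

/-- The complex number `√(-2) = √2 · i`. -/
noncomputable def sqrtNegTwo : ℂ := (Real.sqrt 2 : ℂ) * Complex.I

end TwoCubes

namespace TwoCubes

open MvPolynomial

/-! If `p = f ^ 3 + g ^ 3` with `f`, `g` independent, then `f` and `g` span a plane in the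
three-dimensional space of binary quadratic forms, and this plane has a normal vector, recorded as
`(u, v, w)`. The number `u ^ 2 + v * w` is, up to scaling, the resultant of `f` and `g`. If it
vanishes, `f` and `g` share a root and `p` has a triple root. Otherwise it can be normalised to 1,
and then `mirror u v w` is an involution fixing every form of the plane, hence fixing `p`.

A plane contains at most one representation of `p` (`sum_cubes_unique`), because a binary cubic is a
sum of two cubes in at most one way. A form with a triple root has at most one representation in
all. For any other `p`, representations correspond injectively to involutions fixing `p`, up to
sign.

Two such involutions have a product whose eigenvectors give coordinates in which `p` is `B t` up to
scaling, unless the involutions anticommute and `p` is `x y (b x ^ 4 + d x ^ 2 y ^ 2 + b y ^ 4)`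
(`pair_normal_form`). Three pairwise anticommuting involutions are impossible: in these coordinates
the third would be diagonal and would change the sign of `p`. So three representations force `p` to
be similar to some `B t`.

It remains to count for `B t`. `mirror_of_comp_B_eq` lists the involutions fixing it: three dihedral
ones always, one more if `t = 0`, three more if `t ^ 2 = -50`, where `B t` has the symmetry of the
octahedron. Each comes from a representation, except that the dihedral ones give none when `t ^ 2 =
4`. -/

/-! ### Linear substitutions and the invariance of `N` under similarity. -/

theorem comp_add (f g : Poly) (M : Matrix (Fin 2) (Fin 2) ℂ) :
    comp (f + g) M = comp f M + comp g M := map_add _ _ _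

theorem comp_mul (f g : Poly) (M : Matrix (Fin 2) (Fin 2) ℂ) :
    comp (f * g) M = comp f M * comp g M := map_mul _ _ _

theorem comp_pow (f : Poly) (n : ℕ) (M : Matrix (Fin 2) (Fin 2) ℂ) :
    comp (f ^ n) M = comp f M ^ n := map_pow _ _ _

theorem comp_C (a : ℂ) (M : Matrix (Fin 2) (Fin 2) ℂ) : comp (C a) M = C a := by
  simp [comp]

theorem comp_X (i : Fin 2) (M : Matrix (Fin 2) (Fin 2) ℂ) :
    comp (X i) M = C (M i 0) * X 0 + C (M i 1) * X 1 := by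
  simp [comp]

theorem comp_smul (a : ℂ) (f : Poly) (M : Matrix (Fin 2) (Fin 2) ℂ) :
    comp (a • f) M = a • comp f M := map_smul _ _ _

theorem comp_zero (M : Matrix (Fin 2) (Fin 2) ℂ) : comp 0 M = 0 := map_zero _

theorem comp_comp (f : Poly) (M N : Matrix (Fin 2) (Fin 2) ℂ) :
    comp (comp f M) N = comp f (M * N) := by
  induction f using MvPolynomial.induction_on with
  | C a => simp [comp_C]
  | add p q hp hq => simp [comp_add, hp, hq]
  | mul_X p i hp =>
    rw [comp_mul, comp_mul, comp_mul, hp, comp_X, comp_X, comp_add, comp_mul, comp_mul, comp_X,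
      comp_X, comp_C, comp_C, Matrix.mul_apply, Matrix.mul_apply, Fin.sum_univ_two,
      Fin.sum_univ_two]
    simp only [map_add, map_mul]
    ring

theorem comp_one (f : Poly) : comp f 1 = f := by
  induction f using MvPolynomial.induction_on with
  | C a => simp [comp_C]
  | add p q hp hq => simp [comp_add, hp, hq]
  | mul_X p i hp =>
    rw [comp_mul, hp, comp_X]
    congr 1
    revert i
    simp [Fin.forall_fin_two]

theorem comp_comp_inv (f : Poly) {M : Matrix (Fin 2) (Fin 2) ℂ} (hM : M.det ≠ 0) :
    comp (comp f M) M⁻¹ = f := by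
  rw [comp_comp, Matrix.mul_nonsing_inv _ (isUnit_iff_ne_zero.2 hM), comp_one]

theorem comp_injective {M : Matrix (Fin 2) (Fin 2) ℂ} (hM : M.det ≠ 0) :
    Function.Injective (fun f : Poly => comp f M) := fun f g h => by
  rw [← comp_comp_inv f hM, ← comp_comp_inv g hM]
  exact congrArg (comp · M⁻¹) h

theorem det_inv_ne_zero {M : Matrix (Fin 2) (Fin 2) ℂ} (hM : M.det ≠ 0) : M⁻¹.det ≠ 0 := by
  rw [Matrix.det_nonsing_inv]
  simpa using hM

theorem Similar.symm {f g : Poly} (h : Similar f g) : Similar g f := by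
  obtain ⟨M, hM, rfl⟩ := h
  exact ⟨M⁻¹, det_inv_ne_zero hM, (comp_comp_inv f hM).symm⟩

theorem Similar.trans {f g h : Poly} (hfg : Similar f g) (hgh : Similar g h) : Similar f h := by
  obtain ⟨M, hM, rfl⟩ := hfg
  obtain ⟨M', hM', rfl⟩ := hgh
  exact ⟨M * M', by rw [Matrix.det_mul]; exact mul_ne_zero hM hM', comp_comp _ _ _⟩

theorem IsHomogeneous.comp {f : Poly} {n : ℕ} (hf : f.IsHomogeneous n)
    (M : Matrix (Fin 2) (Fin 2) ℂ) : (comp f M).IsHomogeneous n := by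
  have h := hf.aeval (fun i : Fin 2 => C (M i 0) * X 0 + C (M i 1) * X 1 : Fin 2 → Poly) (n := 1)
    (fun i => ((isHomogeneous_C_mul_X _ _).add (isHomogeneous_C_mul_X _ _)))
  rw [one_mul] at h
  exact h

theorem mem_representations_comp {p : Poly} {M : Matrix (Fin 2) (Fin 2) ℂ} (hM : M.det ≠ 0)
    {s : Sym2 Poly} (hs : s ∈ representations p) :
    Sym2.map (comp · M) s ∈ representations (comp p M) := by
  obtain ⟨f, g, hf, hg, hfg, rfl, rfl⟩ := hs
  refine ⟨comp f M, comp g M, IsHomogeneous.comp hf M, IsHomogeneous.comp hg M, ?_, ?_, ?_⟩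
  · rw [LinearIndependent.pair_iff] at hfg ⊢
    intro a b h
    refine hfg a b (comp_injective hM ?_)
    simpa [comp_add, comp_smul, comp_zero] using h
  · simp [comp_add, comp_pow]
  · simp [comp_pow]

theorem N_le_N_comp (p : Poly) {M : Matrix (Fin 2) (Fin 2) ℂ} (hM : M.det ≠ 0) :
    N p ≤ N (comp p M) := by
  rw [N, ← (Sym2.map.injective (comp_injective hM)).encard_image]
  refine Set.encard_le_encard ?_
  rintro _ ⟨s, hs, rfl⟩
  exact mem_representations_comp hM hs

theorem N_comp (p : Poly) {M : Matrix (Fin 2) (Fin 2) ℂ} (hM : M.det ≠ 0) :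
    N (comp p M) = N p := by
  refine le_antisymm ?_ (N_le_N_comp p hM)
  conv_rhs => rw [← comp_comp_inv p hM]
  exact N_le_N_comp _ (det_inv_ne_zero hM)

theorem Similar.N_eq {p q : Poly} (h : Similar p q) : N q = N p := by
  obtain ⟨M, hM, rfl⟩ := h
  exact N_comp p hM

/-! ### Coefficients of quadratic and sextic forms. -/

/-- The binary quadratic form `a x ^ 2 + b x y + c y ^ 2`. -/
noncomputable def quad (a b c : ℂ) : Poly :=
  C a * X 0 ^ 2 + C b * X 0 * X 1 + C c * X 1 ^ 2

/-- The binary sextic form with the given coefficients, from `x ^ 6` to `y ^ 6`. -/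
noncomputable def sext (a b c d e f g : ℂ) : Poly :=
  C a * X 0 ^ 6 + C b * X 0 ^ 5 * X 1 + C c * X 0 ^ 4 * X 1 ^ 2 + C d * X 0 ^ 3 * X 1 ^ 3 +
    C e * X 0 ^ 2 * X 1 ^ 4 + C f * X 0 * X 1 ^ 5 + C g * X 1 ^ 6

theorem IsHomogeneous.eq_sum {p : Poly} {n : ℕ} (hp : p.IsHomogeneous n) :
    ∃ a : ℕ → ℂ, p = ∑ i ∈ Finset.range (n + 1), C (a i) * X 0 ^ (n - i) * X 1 ^ i := by
  refine ⟨fun i => coeff (Finsupp.single 0 (n - i) + Finsupp.single 1 i) p, ?_⟩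
  have key : ∀ (c : ℂ) (i j : ℕ), (C c * X 0 ^ i * X 1 ^ j : Poly) =
      monomial (Finsupp.single 0 i + Finsupp.single 1 j) c := by
    intro c i j
    rw [X_pow_eq_monomial, X_pow_eq_monomial, C_mul_monomial, monomial_mul]
    simp
  ext d
  simp_rw [key, coeff_sum, coeff_monomial]
  have hd : d = Finsupp.single 0 (d 0) + Finsupp.single 1 (d 1) := by
    ext i
    fin_cases i <;> simp
  by_cases h : d 0 + d 1 = n
  · rw [Finset.sum_eq_single (d 1)]
    · have : n - d 1 = d 0 := by omega
      rw [this, ← hd, if_pos rfl]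
    · intro j _ hj
      rw [if_neg]
      intro h'
      apply hj
      rw [← h']
      simp
    · intro h'
      exact absurd (Finset.mem_range.2 (by omega)) h'
  · rw [hp.coeff_eq_zero, Finset.sum_eq_zero]
    · intro j hj
      rw [if_neg]
      rintro rfl
      apply h
      have := Finset.mem_range.1 hj
      simp
      omega
    · rw [Finsupp.degree_eq_sum, Fin.sum_univ_two]
      exact h

theorem IsHomogeneous.exists_quad {p : Poly} (hp : p.IsHomogeneous 2) :
    ∃ a b c, p = quad a b c := by
  obtain ⟨a, ha⟩ := IsHomogeneous.eq_sum hp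
  refine ⟨a 0, a 1, a 2, ?_⟩
  rw [ha]
  simp [Finset.sum_range_succ, quad]

theorem IsHomogeneous.exists_sext {p : Poly} (hp : p.IsHomogeneous 6) :
    ∃ a b c d e f g, p = sext a b c d e f g := by
  obtain ⟨a, ha⟩ := IsHomogeneous.eq_sum hp
  refine ⟨a 0, a 1, a 2, a 3, a 4, a 5, a 6, ?_⟩
  rw [ha]
  simp [Finset.sum_range_succ, sext]

theorem isHomogeneous_quad (a b c : ℂ) : (quad a b c).IsHomogeneous 2 := by
  have h0 : (X 0 : Poly).IsHomogeneous 1 := isHomogeneous_X _ _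
  have h1 : (X 1 : Poly).IsHomogeneous 1 := isHomogeneous_X _ _
  refine ((?_ : IsHomogeneous _ 2).add ?_).add ?_
  · simpa using (isHomogeneous_C (Fin 2) a).mul (h0.pow 2)
  · simpa using ((isHomogeneous_C (Fin 2) b).mul h0).mul h1
  · simpa using (isHomogeneous_C (Fin 2) c).mul (h1.pow 2)

theorem sext_inj {a b c d e f g a' b' c' d' e' f' g' : ℂ}
    (h : sext a b c d e f g = sext a' b' c' d' e' f' g') :
    a = a' ∧ b = b' ∧ c = c' ∧ d = d' ∧ e = e' ∧ f = f' ∧ g = g' := by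
  -- Setting `x = 1` turns the coefficients into those of a univariate polynomial.
  have h1 := congrArg (aeval ![1, Polynomial.X] : Poly →ₐ[ℂ] Polynomial ℂ) h
  simp only [sext, map_add, map_mul, map_pow, aeval_X, aeval_C, Matrix.cons_val_zero,
    Matrix.cons_val_one, one_pow, mul_one, ← Polynomial.C_eq_algebraMap] at h1
  have h2 := fun n => congrArg (Polynomial.coeff · n) h1
  simp only [Polynomial.coeff_add, Polynomial.coeff_C_mul, Polynomial.coeff_X,
    Polynomial.coeff_X_pow, Polynomial.coeff_C] at h2
  exact ⟨by simpa using h2 0, by simpa using h2 1, by simpa using h2 2, by simpa using h2 3,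
    by simpa using h2 4, by simpa using h2 5, by simpa using h2 6⟩

theorem quad_inj {a b c a' b' c' : ℂ} (h : quad a b c = quad a' b' c') :
    a = a' ∧ b = b' ∧ c = c' := by
  -- Multiplication by `x ^ 4` reduces the claim to `sext_inj`.
  have key : ∀ a b c : ℂ, quad a b c * X 0 ^ 4 = sext a b c 0 0 0 0 := by
    intro a b c
    simp only [quad, sext, map_zero]
    ring
  have := sext_inj ((key a b c).symm.trans ((congrArg (· * X 0 ^ 4) h).trans (key a' b' c')))
  exact ⟨this.1, this.2.1, this.2.2.1⟩

theorem smul_quad (r a b c : ℂ) : r • quad a b c = quad (r * a) (r * b) (r * c) := by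
  simp only [quad, smul_eq_C_mul, map_mul]
  ring

theorem quad_add_quad (a b c a' b' c' : ℂ) :
    quad a b c + quad a' b' c' = quad (a + a') (b + b') (c + c') := by
  simp only [quad, map_add]
  ring

theorem quad_zero : quad 0 0 0 = 0 := by simp [quad]

theorem comp_quad (a b c u v w z : ℂ) : comp (quad a b c) !![u, v; w, z] =
    quad (a * u ^ 2 + b * u * w + c * w ^ 2) (2 * a * u * v + b * (u * z + v * w) + 2 * c * w * z)
      (a * v ^ 2 + b * v * z + c * z ^ 2) := by
  simp only [quad, comp_add, comp_mul, comp_pow, comp_C, comp_X, Matrix.of_apply, Matrix.cons_val',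
    Matrix.cons_val_zero, Matrix.cons_val_one, Matrix.cons_val_fin_one, map_add, map_mul, map_pow,
    map_ofNat]
  ring

theorem quad_pow_three (a b c : ℂ) : quad a b c ^ 3 =
    sext (a ^ 3) (3 * a ^ 2 * b) (3 * a ^ 2 * c + 3 * a * b ^ 2) (6 * a * b * c + b ^ 3)
      (3 * a * c ^ 2 + 3 * b ^ 2 * c) (3 * b * c ^ 2) (c ^ 3) := by
  simp only [quad, sext, map_add, map_mul, map_pow, map_ofNat]
  ring

theorem sext_add_sext (a b c d e f g a' b' c' d' e' f' g' : ℂ) :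
    sext a b c d e f g + sext a' b' c' d' e' f' g' =
      sext (a + a') (b + b') (c + c') (d + d') (e + e') (f + f') (g + g') := by
  simp only [sext, map_add]
  ring

theorem B_eq_sext (t : ℂ) : B t = sext 1 0 0 t 0 0 1 := by
  simp [B, sext]

/-! ### Sums of two cubes inside a pencil of quadratic forms. -/

/-- Over `ℂ` a homogeneous polynomial in `f` and `g` splits into linear factors, and a nonzero
linear combination of independent forms is nonzero. The cubic version peels off one factor and falls
back on this one. -/
theorem quadratic_combination_eq_zero {f g : Poly} (hfg : LinearIndependent ℂ ![f, g])
    {a b c : ℂ} (h : C a * f ^ 2 + C b * (f * g) + C c * g ^ 2 = 0) : a = 0 ∧ b = 0 ∧ c = 0 := by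
  have hlin : ∀ a b : ℂ, C a * f + C b * g = 0 → a = 0 ∧ b = 0 := fun a b h =>
    LinearIndependent.pair_iff.1 hfg a b (by simpa [smul_eq_C_mul] using h)
  have hg : g ≠ 0 := by
    rintro rfl
    simpa using hlin 0 1
  by_cases ha : a = 0
  · subst ha
    have h' : g * (C b * f + C c * g) = 0 := by
      rw [← h, C_0]
      ring
    have := hlin b c ((mul_eq_zero.1 h').resolve_left hg)
    exact ⟨rfl, this⟩
  · exfalso
    obtain ⟨r, hr⟩ := IsAlgClosed.exists_root
      (Polynomial.C a * Polynomial.X ^ 2 + Polynomial.C b * Polynomial.X + Polynomial.C c)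
      (by rw [Polynomial.degree_quadratic ha]; decide)
    have hr' : c = -(a * r ^ 2 + b * r) := by
      simp [Polynomial.IsRoot] at hr
      linear_combination hr
    have h' : (C 1 * f + C (-r) * g) * (C a * f + C (b + a * r) * g) = 0 := by
      rw [← h, hr']
      simp only [map_add, map_neg, map_mul, map_pow, map_one]
      ring
    rcases mul_eq_zero.1 h' with h' | h'
    · exact one_ne_zero (hlin _ _ h').1
    · exact ha (hlin _ _ h').1

theorem cubic_combination_eq_zero {f g : Poly} (hfg : LinearIndependent ℂ ![f, g])
    {a b c d : ℂ} (h : C a * f ^ 3 + C b * (f ^ 2 * g) + C c * (f * g ^ 2) + C d * g ^ 3 = 0) :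
    a = 0 ∧ b = 0 ∧ c = 0 ∧ d = 0 := by
  have hlin : ∀ a b : ℂ, C a * f + C b * g = 0 → a = 0 ∧ b = 0 := fun a b h =>
    LinearIndependent.pair_iff.1 hfg a b (by simpa [smul_eq_C_mul] using h)
  have hg : g ≠ 0 := by
    rintro rfl
    simpa using hlin 0 1
  by_cases ha : a = 0
  · subst ha
    have h' : g * (C b * f ^ 2 + C c * (f * g) + C d * g ^ 2) = 0 := by
      rw [← h, C_0]
      ring
    exact ⟨rfl, quadratic_combination_eq_zero hfg ((mul_eq_zero.1 h').resolve_left hg)⟩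
  · exfalso
    obtain ⟨r, hr⟩ := IsAlgClosed.exists_root
      (Polynomial.C a * Polynomial.X ^ 3 + Polynomial.C b * Polynomial.X ^ 2 +
        Polynomial.C c * Polynomial.X + Polynomial.C d)
      (by rw [Polynomial.degree_cubic ha]; decide)
    have hr' : d = -(a * r ^ 3 + b * r ^ 2 + c * r) := by
      simp [Polynomial.IsRoot] at hr
      linear_combination hr
    have h' : (C 1 * f + C (-r) * g) *
        (C a * f ^ 2 + C (b + a * r) * (f * g) + C (c + b * r + a * r ^ 2) * g ^ 2) = 0 := by
      rw [← h, hr']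
      simp only [map_add, map_neg, map_mul, map_pow, map_one]
      ring
    rcases mul_eq_zero.1 h' with h' | h'
    · exact one_ne_zero (hlin _ _ h').1
    · exact ha (quadratic_combination_eq_zero hfg h').1

theorem sum_cubes_combination {f g : Poly} (α β γ δ : ℂ) :
    (α • f + β • g) ^ 3 + (γ • f + δ • g) ^ 3 =
      C (α ^ 3 + γ ^ 3) * f ^ 3 + C (3 * (α ^ 2 * β + γ ^ 2 * δ)) * (f ^ 2 * g) +
        C (3 * (α * β ^ 2 + γ * δ ^ 2)) * (f * g ^ 2) + C (β ^ 3 + δ ^ 3) * g ^ 3 := by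
  simp only [smul_eq_C_mul, map_add, map_mul, map_pow, map_ofNat]
  ring

theorem sum_cubes_coeffs {f g : Poly} (hfg : LinearIndependent ℂ ![f, g])
    {α β γ δ a b c d : ℂ}
    (h : (α • f + β • g) ^ 3 + (γ • f + δ • g) ^ 3 =
      C a * f ^ 3 + C (3 * b) * (f ^ 2 * g) + C (3 * c) * (f * g ^ 2) + C d * g ^ 3) :
    α ^ 3 + γ ^ 3 = a ∧ α ^ 2 * β + γ ^ 2 * δ = b ∧ α * β ^ 2 + γ * δ ^ 2 = c ∧
      β ^ 3 + δ ^ 3 = d := by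
  rw [sum_cubes_combination, ← sub_eq_zero] at h
  obtain ⟨h0, h1, h2, h3⟩ := cubic_combination_eq_zero hfg
    (a := α ^ 3 + γ ^ 3 - a) (b := 3 * (α ^ 2 * β + γ ^ 2 * δ) - 3 * b)
    (c := 3 * (α * β ^ 2 + γ * δ ^ 2) - 3 * c) (d := β ^ 3 + δ ^ 3 - d) (by
      rw [← h]
      simp only [map_sub]
      ring)
  exact ⟨by linear_combination h0, by linear_combination h1 / 3, by linear_combination h2 / 3,
    by linear_combination h3⟩

theorem det_ne_zero_of_linearIndependent {f g : Poly} {α β γ δ : ℂ}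
    (h : LinearIndependent ℂ ![α • f + β • g, γ • f + δ • g]) : α * δ - β * γ ≠ 0 := by
  intro hdet
  rw [LinearIndependent.pair_iff] at h
  have h1 := h δ (-β) (by
    rw [smul_add, smul_add, smul_smul, smul_smul, smul_smul, smul_smul]
    have e1 : δ * α = β * γ := by linear_combination hdet
    have e2 : δ * β = β * δ := mul_comm _ _
    rw [e1, e2, neg_mul, neg_mul, neg_smul, neg_smul]
    abel)
  have h2 := h γ (-α) (by
    rw [smul_add, smul_add, smul_smul, smul_smul, smul_smul, smul_smul]
    have e1 : γ * β = α * δ := by linear_combination -hdet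
    have e2 : γ * α = α * γ := mul_comm _ _
    rw [e1, e2, neg_mul, neg_mul, neg_smul, neg_smul]
    abel)
  have h3 := h 1 0 (by
    rw [neg_eq_zero.1 h1.2, neg_eq_zero.1 h2.2]
    simp)
  exact one_ne_zero h3.1

/-- Within a pencil, a form is a sum of two cubes in at most one way. -/
theorem sum_cubes_unique {f g f' g' : Poly} (hfg : LinearIndependent ℂ ![f, g])
    (hfg' : LinearIndependent ℂ ![f', g']) {α β γ δ : ℂ} (hf' : f' = α • f + β • g)
    (hg' : g' = γ • f + δ • g) (h : f' ^ 3 + g' ^ 3 = f ^ 3 + g ^ 3) :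
    s(f' ^ 3, g' ^ 3) = s(f ^ 3, g ^ 3) := by
  subst hf' hg'
  have hdet := det_ne_zero_of_linearIndependent hfg'
  obtain ⟨h0, h1, h2, h3⟩ := sum_cubes_coeffs (a := 1) (b := 0) (c := 0) (d := 1) hfg (by
    rw [h]
    simp)
  -- Eliminating between the two mixed coefficients leaves `α δ β γ` times the determinant. So the
  -- change of basis is diagonal or antidiagonal, with cube roots of unity as entries.
  have hprod : (α * δ) * (β * γ) = 0 := by
    have : (α * δ) * (β * γ) * (α * δ - β * γ) = 0 := by
      linear_combination γ * δ ^ 2 * h1 - γ ^ 2 * δ * h2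
    exact (mul_eq_zero.1 this).resolve_right hdet
  have hcube : ∀ (r : ℂ) (k : Poly), r ^ 3 = 1 → (r • k) ^ 3 = k ^ 3 := by
    intro r k hr
    rw [smul_pow, hr, one_smul]
  rcases mul_eq_zero.1 hprod with h' | h'
  · have hβγ : β * γ ≠ 0 := by
      intro h''
      exact hdet (by rw [h', h'', sub_zero])
    obtain ⟨hβ, hγ⟩ := mul_ne_zero_iff.1 hβγ
    have hα : α = 0 := by
      rcases mul_eq_zero.1 h' with h' | h'
      · exact h'
      · subst h'
        simpa [hβ] using h1
    subst hα
    have hδ : δ = 0 := by simpa [hγ] using h1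
    subst hδ
    rw [zero_smul, zero_smul, zero_add, add_zero, hcube β g (by simpa using h3),
      hcube γ f (by simpa using h0), Sym2.eq_swap]
  · have hαδ : α * δ ≠ 0 := by
      intro h''
      exact hdet (by rw [h', h'', sub_zero])
    obtain ⟨hα, hδ⟩ := mul_ne_zero_iff.1 hαδ
    have hβ : β = 0 := by
      rcases mul_eq_zero.1 h' with h' | h'
      · exact h'
      · subst h'
        simpa [hα] using h1
    subst hβ
    have hγ : γ = 0 := by simpa [hδ] using h1
    subst hγ
    rw [zero_smul, zero_smul, zero_add, add_zero, hcube α f (by simpa using h0),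
      hcube δ g (by simpa using h3)]

/-! ### Planes of quadratic forms and the involutions that fix them. -/

/-- Three vectors of `ℂ ^ 3` orthogonal to a nonzero `n` are dependent, and the first two are
independent. -/
theorem exists_combination {a b c a' b' c' a'' b'' c'' : ℂ} {n : Fin 3 → ℂ} (hn : n ≠ 0)
    (h : a * n 0 + b * n 1 + c * n 2 = 0) (h' : a' * n 0 + b' * n 1 + c' * n 2 = 0)
    (h'' : a'' * n 0 + b'' * n 1 + c'' * n 2 = 0)
    (hind : LinearIndependent ℂ ![quad a b c, quad a' b' c']) :
    ∃ α β : ℂ, quad a'' b'' c'' = α • quad a b c + β • quad a' b' c' := by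
  have hdet : (!![a, b, c; a', b', c'; a'', b'', c''] : Matrix (Fin 3) (Fin 3) ℂ).det = 0 := by
    refine Matrix.exists_mulVec_eq_zero_iff.1 ⟨n, hn, ?_⟩
    ext i
    fin_cases i
    · simpa [Matrix.mulVec, dotProduct, Fin.sum_univ_three] using h
    · simpa [Matrix.mulVec, dotProduct, Fin.sum_univ_three] using h'
    · simpa [Matrix.mulVec, dotProduct, Fin.sum_univ_three] using h''
  obtain ⟨x, hx, hx0⟩ := Matrix.exists_vecMul_eq_zero_iff.2 hdet
  have e0 := congrFun hx0 0
  have e1 := congrFun hx0 1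
  have e2 := congrFun hx0 2
  simp [Matrix.vecMul, dotProduct, Fin.sum_univ_three] at e0 e1 e2
  have hx2 : x 2 ≠ 0 := by
    intro h2
    rw [LinearIndependent.pair_iff] at hind
    have := hind (x 0) (x 1) (by
      rw [smul_quad, smul_quad, quad_add_quad, ← quad_zero]
      congr 1
      · linear_combination e0 - a'' * h2
      · linear_combination e1 - b'' * h2
      · linear_combination e2 - c'' * h2)
    apply hx
    ext i
    fin_cases i
    exacts [this.1, this.2, h2]
  refine ⟨-x 0 / x 2, -x 1 / x 2, ?_⟩
  rw [smul_quad, smul_quad, quad_add_quad]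
  congr 1
  · field_simp
    linear_combination e0
  · field_simp
    linear_combination e1
  · field_simp
    linear_combination e2

/-- The matrix with trace zero and determinant `-(u ^ 2 + v * w)`; it is a non-scalar involution when
`u ^ 2 + v * w = 1`. -/
def mirror (u v w : ℂ) : Matrix (Fin 2) (Fin 2) ℂ := !![u, v; w, -u]

/-- `s` is a representation of `p` by quadratic forms in the plane apolar to `(u, v, w)`; when
`u ^ 2 + v * w = 1` these are the quadratic forms invariant under `mirror u v w`. -/
def FixedBy (p : Poly) (u v w : ℂ) (s : Sym2 Poly) : Prop :=
  ∃ a b c a' b' c' : ℂ, LinearIndependent ℂ ![quad a b c, quad a' b' c'] ∧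
    quad a b c ^ 3 + quad a' b' c' ^ 3 = p ∧ s = s(quad a b c ^ 3, quad a' b' c' ^ 3) ∧
    a * v = b * u + c * w ∧ a' * v = b' * u + c' * w

/-- Some root of the binary sextic form `p` has multiplicity at least three. -/
def HasTripleRoot (p : Poly) : Prop :=
  ∃ M : Matrix (Fin 2) (Fin 2) ℂ, M.det ≠ 0 ∧ ∃ d e f g, comp p M = sext 0 0 0 d e f g

theorem exists_quads_of_mem_representations {p : Poly} {s : Sym2 Poly}
    (hs : s ∈ representations p) :
    ∃ a b c a' b' c' : ℂ, LinearIndependent ℂ ![quad a b c, quad a' b' c'] ∧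
      quad a b c ^ 3 + quad a' b' c' ^ 3 = p ∧ s = s(quad a b c ^ 3, quad a' b' c' ^ 3) := by
  obtain ⟨f, g, hf, hg, hfg, h, hs⟩ := hs
  obtain ⟨a, b, c, rfl⟩ := IsHomogeneous.exists_quad hf
  obtain ⟨a', b', c', rfl⟩ := IsHomogeneous.exists_quad hg
  exact ⟨a, b, c, a', b', c', hfg, h, hs⟩

theorem FixedBy.mem {p : Poly} {u v w : ℂ} {s : Sym2 Poly} (h : FixedBy p u v w s) :
    s ∈ representations p := by
  obtain ⟨a, b, c, a', b', c', hind, hp, hs, -, -⟩ := h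
  exact ⟨_, _, isHomogeneous_quad _ _ _, isHomogeneous_quad _ _ _, hind, hp, hs⟩

theorem FixedBy.neg {p : Poly} {u v w : ℂ} {s : Sym2 Poly} (h : FixedBy p u v w s) :
    FixedBy p (-u) (-v) (-w) s := by
  obtain ⟨a, b, c, a', b', c', hind, hp, hs, h1, h2⟩ := h
  exact ⟨a, b, c, a', b', c', hind, hp, hs, by linear_combination -h1,
    by linear_combination -h2⟩

theorem comp_quad_mirror {a b c u v w : ℂ} (h1 : u ^ 2 + v * w = 1) (h : a * v = b * u + c * w) :
    comp (quad a b c) (mirror u v w) = quad a b c := by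
  rw [mirror, comp_quad]
  congr 1
  · linear_combination a * h1 - w * h
  · linear_combination b * h1 + 2 * u * h
  · linear_combination c * h1 + v * h

theorem FixedBy.comp_eq {p : Poly} {u v w : ℂ} {s : Sym2 Poly} (h : FixedBy p u v w s)
    (h1 : u ^ 2 + v * w = 1) : comp p (mirror u v w) = p := by
  obtain ⟨a, b, c, a', b', c', hind, rfl, hs, h2, h3⟩ := h
  rw [comp_add, comp_pow, comp_pow, comp_quad_mirror h1 h2, comp_quad_mirror h1 h3]

theorem FixedBy.unique {p : Poly} {u v w : ℂ} (h0 : ¬(u = 0 ∧ v = 0 ∧ w = 0)) {s s' : Sym2 Poly}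
    (h : FixedBy p u v w s) (h' : FixedBy p u v w s') : s' = s := by
  obtain ⟨a, b, c, a', b', c', hind, hp, rfl, h1, h2⟩ := h
  obtain ⟨d, e, f, d', e', f', hind', hp', rfl, h1', h2'⟩ := h'
  have hn : (![v, -u, -w] : Fin 3 → ℂ) ≠ 0 := by
    intro h
    apply h0
    have e0 := congrFun h 0
    have e1 := congrFun h 1
    have e2 := congrFun h 2
    simp at e0 e1 e2
    exact ⟨e1, e0, e2⟩
  have key : ∀ a b c : ℂ, a * v = b * u + c * w →
      a * (![v, -u, -w] : Fin 3 → ℂ) 0 + b * (![v, -u, -w] : Fin 3 → ℂ) 1 +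
        c * (![v, -u, -w] : Fin 3 → ℂ) 2 = 0 := by
    intro a b c h
    simp
    linear_combination h
  obtain ⟨α, β, hαβ⟩ := exists_combination hn (key _ _ _ h1) (key _ _ _ h2) (key _ _ _ h1') hind
  obtain ⟨γ, δ, hγδ⟩ := exists_combination hn (key _ _ _ h1) (key _ _ _ h2) (key _ _ _ h2') hind
  exact sum_cubes_unique hind hind' hαβ hγδ (hp'.trans hp.symm)

theorem cross_ne_zero {a b c a' b' c' : ℂ} (h : LinearIndependent ℂ ![quad a b c, quad a' b' c']) :
    ¬(b * c' - b' * c = 0 ∧ c * a' - c' * a = 0 ∧ a * b' - a' * b = 0) := by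
  rintro ⟨h0, h1, h2⟩
  rw [LinearIndependent.pair_iff] at h
  have key : ∀ r r' : ℂ, r * a + r' * a' = 0 → r * b + r' * b' = 0 → r * c + r' * c' = 0 →
      r = 0 ∧ r' = 0 := fun r r' e0 e1 e2 =>
    h r r' (by rw [smul_quad, smul_quad, quad_add_quad, e0, e1, e2, quad_zero])
  have ha := key a' (-a) (by ring) (by linear_combination -h2) (by linear_combination h1)
  have hb := key b' (-b) (by linear_combination h2) (by ring) (by linear_combination -h0)
  have hc := key c' (-c) (by linear_combination -h1) (by linear_combination h0) (by ring)
  have := key 1 0 (by linear_combination -ha.2) (by linear_combination -hb.2)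
    (by linear_combination -hc.2)
  exact one_ne_zero this.1

/-- The normal of a plane is unique up to a scalar, so it is a multiple of the cross product of a
basis. -/
theorem exists_eq_mul_cross {a b c a' b' c' u v w : ℂ}
    (h : LinearIndependent ℂ ![quad a b c, quad a' b' c']) (h1 : a * v = b * u + c * w)
    (h2 : a' * v = b' * u + c' * w) :
    ∃ k, v = k * (b * c' - b' * c) ∧ -u = k * (c * a' - c' * a) ∧ -w = k * (a * b' - a' * b) := by
  by_cases hx : b * c' - b' * c = 0
  · by_cases hy : c * a' - c' * a = 0
    · have hz : a * b' - a' * b ≠ 0 := fun hz => cross_ne_zero h ⟨hx, hy, hz⟩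
      refine ⟨-w / (a * b' - a' * b), ?_, ?_, ?_⟩ <;> field_simp
      · linear_combination b' * h1 - b * h2
      · linear_combination -a' * h1 + a * h2
    · refine ⟨-u / (c * a' - c' * a), ?_, ?_, ?_⟩ <;> field_simp
      · linear_combination -c' * h1 + c * h2
      · linear_combination a' * h1 - a * h2
  · refine ⟨v / (b * c' - b' * c), ?_, ?_, ?_⟩ <;> field_simp
    · linear_combination c' * h1 - c * h2
    · linear_combination -b' * h1 + b * h2

theorem smul_of_pow_three_eq {f g : Poly} (h : f ^ 3 = g ^ 3) : ∃ r : ℂ, r ≠ 0 ∧ g = r • f := by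
  obtain ⟨ω, hω⟩ := IsAlgClosed.exists_root
      (Polynomial.C 1 * Polynomial.X ^ 2 + Polynomial.C 1 * Polynomial.X + Polynomial.C (1 : ℂ))
      (by rw [Polynomial.degree_quadratic one_ne_zero]; decide)
  have hω' : ω ^ 2 + ω + 1 = 0 := by simpa [Polynomial.IsRoot] using hω
  have hω3 : ω ^ 3 = 1 := by linear_combination (ω - 1) * hω'
  have hω0 : ω ≠ 0 := by
    rintro rfl
    simp at hω'
  have hC : (C ω : Poly) ^ 2 + C ω + 1 = 0 := by
    rw [← C_pow, ← C_add, ← C_1, ← C_add, hω', C_0]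
  -- This is `g ^ 3 - f ^ 3` split by the cube roots of unity.
  have : (g - f) * (g - C ω * f) * (g - C (ω ^ 2) * f) = 0 := by
    rw [C_pow]
    linear_combination -h + (g * f ^ 2 * C ω - f * g ^ 2 - f ^ 3 * (C ω - 1)) * hC
  rcases mul_eq_zero.1 this with h' | h'
  · rcases mul_eq_zero.1 h' with h' | h'
    · exact ⟨1, one_ne_zero, by rw [one_smul]; exact sub_eq_zero.1 h'⟩
    · exact ⟨ω, hω0, by rw [smul_eq_C_mul]; exact sub_eq_zero.1 h'⟩
  · exact ⟨ω ^ 2, pow_ne_zero 2 hω0, by rw [smul_eq_C_mul]; exact sub_eq_zero.1 h'⟩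

theorem apolar_of_pow_three_eq {a b c d e f u v w : ℂ}
    (h : quad a b c ^ 3 = quad d e f ^ 3) (h' : a * v = b * u + c * w) : d * v = e * u + f * w := by
  obtain ⟨r, -, hr⟩ := smul_of_pow_three_eq h
  rw [smul_quad] at hr
  obtain ⟨rfl, rfl, rfl⟩ := quad_inj hr
  linear_combination r * h'

/-- A representation determines the involution that fixes it, up to sign. -/
theorem FixedBy.eq_or_eq_neg {p : Poly} {u v w u' v' w' : ℂ} {s : Sym2 Poly}
    (h1 : u ^ 2 + v * w = 1) (h1' : u' ^ 2 + v' * w' = 1)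
    (h : FixedBy p u v w s) (h' : FixedBy p u' v' w' s) :
    (u' = u ∧ v' = v ∧ w' = w) ∨ (u' = -u ∧ v' = -v ∧ w' = -w) := by
  obtain ⟨a, b, c, a', b', c', hind, -, rfl, h2, h3⟩ := h
  obtain ⟨d, e, f, d', e', f', -, -, hs, h2', h3'⟩ := h'
  have h4 : a * v' = b * u' + c * w' ∧ a' * v' = b' * u' + c' * w' := by
    rcases Sym2.eq_iff.1 hs with ⟨e1, e2⟩ | ⟨e1, e2⟩
    · exact ⟨apolar_of_pow_three_eq e1.symm h2', apolar_of_pow_three_eq e2.symm h3'⟩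
    · exact ⟨apolar_of_pow_three_eq e1.symm h3', apolar_of_pow_three_eq e2.symm h2'⟩
  obtain ⟨k, hk0, hk1, hk2⟩ := exists_eq_mul_cross hind h2 h3
  obtain ⟨l, hl0, hl1, hl2⟩ := exists_eq_mul_cross hind h4.1 h4.2
  -- Both normals are multiples of one cross product, and the normalisation to 1 fixes the multiple
  -- up to sign.
  rw [hk0, neg_eq_iff_eq_neg.1 hk1, neg_eq_iff_eq_neg.1 hk2] at h1 ⊢
  rw [hl0, neg_eq_iff_eq_neg.1 hl1, neg_eq_iff_eq_neg.1 hl2] at h1' ⊢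
  have hkl : (l - k) * (l + k) = 0 := by
    linear_combination (-l ^ 2) * h1 + k ^ 2 * h1'
  rcases mul_eq_zero.1 hkl with hkl | hkl
  · left
    rw [sub_eq_zero.1 hkl]
    exact ⟨rfl, rfl, rfl⟩
  · right
    rw [eq_neg_of_add_eq_zero_left hkl]
    refine ⟨?_, ?_, ?_⟩ <;> ring

/-! ### Triple roots. -/

/-- The hypotheses say `f ^ 3 ≡ -g ^ 3` modulo `y ^ 3`. If the leading coefficients were nonzero,
taking cube roots would give `f ≡ ζ g` modulo `y ^ 3` for a constant `ζ`. A quadratic form is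
determined modulo `y ^ 3`, so `f` and `g` would be proportional. -/
theorem dependent_of_cubes {a b c a' b' c' : ℂ} (h0 : a ^ 3 + a' ^ 3 = 0)
    (h1 : a ^ 2 * b + a' ^ 2 * b' = 0) (h2 : a ^ 2 * c + a * b ^ 2 + (a' ^ 2 * c' + a' * b' ^ 2) = 0)
    (h : LinearIndependent ℂ ![quad a b c, quad a' b' c']) : a = 0 ∧ a' = 0 := by
  by_cases ha : a = 0
  · subst ha
    exact ⟨rfl, by simpa using h0⟩
  by_cases ha' : a' = 0
  · subst ha'
    exact ⟨by simpa using h0, rfl⟩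
  exfalso
  have hab : a * b' - a' * b = 0 := by
    have : a ^ 2 * a' ^ 2 * (a * b' - a' * b) = 0 := by
      linear_combination a ^ 3 * h1 - a ^ 2 * b * h0
    exact (mul_eq_zero.1 this).resolve_left (by positivity)
  have hca : c * a' - c' * a = 0 := by
    have e1 : b' = a' * b / a := by
      field_simp
      linear_combination hab
    rw [e1] at h2
    field_simp at h2
    have : a ^ 2 * a' ^ 2 * (c * a' - c' * a) = 0 := by
      linear_combination (a ^ 2 * c + a * b ^ 2) * h0 - a * h2
    exact (mul_eq_zero.1 this).resolve_left (by positivity)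
  refine cross_ne_zero h ⟨?_, hca, hab⟩
  have : a * (b * c' - b' * c) = 0 := by
    linear_combination -b * hca - c * hab
  exact (mul_eq_zero.1 this).resolve_left ha

/-- Both quadratic forms must vanish at the triple root `(1 : 0)`, so every representation lies in
the same plane. Its normal `(0, 1, 0)` has `u ^ 2 + v * w = 0` and defines no involution. -/
theorem fixedBy_of_mem_representations_sext {d e f g : ℂ} {s : Sym2 Poly}
    (hs : s ∈ representations (sext 0 0 0 d e f g)) : FixedBy (sext 0 0 0 d e f g) 0 1 0 s := by
  obtain ⟨a, b, c, a', b', c', hind, hp, hs⟩ := exists_quads_of_mem_representations hs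
  refine ⟨a, b, c, a', b', c', hind, hp, hs, ?_⟩
  rw [quad_pow_three, quad_pow_three, sext_add_sext] at hp
  obtain ⟨h0, h1, h2, -⟩ := sext_inj hp
  obtain ⟨ha, ha'⟩ := dependent_of_cubes h0 (by linear_combination h1 / 3)
    (by linear_combination h2 / 3) hind
  simp [ha, ha']

theorem HasTripleRoot.representations_subsingleton {p : Poly} (h : HasTripleRoot p) :
    (representations p).Subsingleton := by
  obtain ⟨M, hM, d, e, f, g, hp⟩ := h
  intro s hs s' hs'
  apply Sym2.map.injective (comp_injective hM)
  have h1 := mem_representations_comp hM hs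
  have h2 := mem_representations_comp hM hs'
  rw [hp] at h1 h2
  exact FixedBy.unique (by simp) (fixedBy_of_mem_representations_sext h2)
    (fixedBy_of_mem_representations_sext h1)

theorem hasTripleRoot_of_common_root {a b c a' b' c' r s : ℂ} (hrs : ¬(r = 0 ∧ s = 0))
    (h : a * r ^ 2 + b * r * s + c * s ^ 2 = 0) (h' : a' * r ^ 2 + b' * r * s + c' * s ^ 2 = 0) :
    HasTripleRoot (quad a b c ^ 3 + quad a' b' c' ^ 3) := by
  have key : ∀ x y : ℂ, (!![r, x; s, y] : Matrix (Fin 2) (Fin 2) ℂ).det ≠ 0 →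
      HasTripleRoot (quad a b c ^ 3 + quad a' b' c' ^ 3) := by
    intro x y hdet
    refine ⟨_, hdet, ?_⟩
    rw [comp_add, comp_pow, comp_pow, comp_quad, comp_quad, h, h', quad_pow_three, quad_pow_three,
      sext_add_sext]
    simp only [ne_eq, OfNat.ofNat_ne_zero, not_false_eq_true, zero_pow, mul_zero, zero_mul, add_zero]
    exact ⟨_, _, _, _, rfl⟩
  by_cases hr : r = 0
  · exact key 1 0 (by simpa [Matrix.det_fin_two] using fun hs => hrs ⟨hr, hs⟩)
  · exact key 0 1 (by simpa [Matrix.det_fin_two] using hr)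

theorem exists_fixedBy {p : Poly} (hp : ¬HasTripleRoot p) {s : Sym2 Poly}
    (hs : s ∈ representations p) :
    ∃ u v w : ℂ, u ^ 2 + v * w = 1 ∧ FixedBy p u v w s := by
  obtain ⟨a, b, c, a', b', c', hind, rfl, hs'⟩ := exists_quads_of_mem_representations hs
  -- The normal is the cross product of the coefficient vectors, and `u ^ 2 + v * w` is then exactly
  -- the resultant of the two forms.
  set v := b * c' - b' * c with hv
  set u := -(c * a' - c' * a) with hu
  set w := -(a * b' - a' * b) with hw
  have h1 : a * v = b * u + c * w := by rw [hv, hu, hw]; ring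
  have h2 : a' * v = b' * u + c' * w := by rw [hv, hu, hw]; ring
  by_cases hq : u ^ 2 + v * w = 0
  · exfalso
    apply hp
    -- When the resultant vanishes, both `(v, -u)` and `(u, w)` satisfy the equation of a common
    -- root. Either pair may be zero, but not both.
    have hvu : ∀ a b c : ℂ, a * v = b * u + c * w → a * v ^ 2 + b * v * (-u) + c * (-u) ^ 2 = 0 := by
      intro a b c h
      linear_combination v * h + c * hq
    have huw : ∀ a b c : ℂ, a * v = b * u + c * w → a * u ^ 2 + b * u * w + c * w ^ 2 = 0 := by
      intro a b c h
      linear_combination -w * h + a * hq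
    by_cases h0 : v = 0 ∧ -u = 0
    · refine hasTripleRoot_of_common_root (r := u) (s := w) ?_ (huw _ _ _ h1) (huw _ _ _ h2)
      rintro ⟨-, h3⟩
      exact cross_ne_zero hind ⟨h0.1, by simpa [hu] using h0.2, by linear_combination -h3⟩
    · exact hasTripleRoot_of_common_root h0 (hvu _ _ _ h1) (hvu _ _ _ h2)
  · obtain ⟨k, hk⟩ := IsAlgClosed.exists_pow_nat_eq (u ^ 2 + v * w) (n := 2) (by norm_num)
    have hk0 : k ≠ 0 := by
      rintro rfl
      exact hq (by rw [← hk]; simp)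
    refine ⟨u / k, v / k, w / k, ?_, a, b, c, a', b', c', hind, rfl, hs', ?_, ?_⟩
    · field_simp
      rw [hk]
    · field_simp
      exact h1
    · field_simp
      exact h2

/-! ### Sextic forms fixed by two involutions. -/

theorem comp_sext_diag (a b c d e f g x y : ℂ) : comp (sext a b c d e f g) !![x, 0; 0, y] =
    sext (a * x ^ 6) (b * x ^ 5 * y) (c * x ^ 4 * y ^ 2) (d * x ^ 3 * y ^ 3) (e * x ^ 2 * y ^ 4)
      (f * x * y ^ 5) (g * y ^ 6) := by
  simp [sext, comp_add, comp_mul, comp_pow, comp_C, comp_X]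
  ring

theorem comp_sext_antidiag (a b c d e f g x y : ℂ) : comp (sext a b c d e f g) !![0, x; y, 0] =
    sext (g * y ^ 6) (f * x * y ^ 5) (e * x ^ 2 * y ^ 4) (d * x ^ 3 * y ^ 3) (c * x ^ 4 * y ^ 2)
      (b * x ^ 5 * y) (a * x ^ 6) := by
  simp [sext, comp_add, comp_mul, comp_pow, comp_C, comp_X]
  ring

theorem comp_sext_upper (a b c d e f g x k : ℂ) : comp (sext a b c d e f g) !![x, k; 0, x] =
    sext (a * x ^ 6) (6 * a * x ^ 5 * k + b * x ^ 6)
      (15 * a * x ^ 4 * k ^ 2 + 5 * b * x ^ 5 * k + c * x ^ 6)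
      (20 * a * x ^ 3 * k ^ 3 + 10 * b * x ^ 4 * k ^ 2 + 4 * c * x ^ 5 * k + d * x ^ 6)
      (15 * a * x ^ 2 * k ^ 4 + 10 * b * x ^ 3 * k ^ 3 + 6 * c * x ^ 4 * k ^ 2 + 3 * d * x ^ 5 * k +
        e * x ^ 6)
      (6 * a * x * k ^ 5 + 5 * b * x ^ 2 * k ^ 4 + 4 * c * x ^ 3 * k ^ 3 + 3 * d * x ^ 4 * k ^ 2 +
        2 * e * x ^ 5 * k + f * x ^ 6)
      (a * k ^ 6 + b * x * k ^ 5 + c * x ^ 2 * k ^ 4 + d * x ^ 3 * k ^ 3 + e * x ^ 4 * k ^ 2 +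
        f * x ^ 5 * k + g * x ^ 6) := by
  simp [sext, comp_add, comp_mul, comp_pow, comp_C, comp_X]
  simp only [map_ofNat]
  ring

theorem comp_conj_eq {p : Poly} {A A' M : Matrix (Fin 2) (Fin 2) ℂ} (h : comp p A = p)
    (hA : A * M = M * A') : comp (comp p M) A' = comp p M := by
  rw [comp_comp, ← hA, ← comp_comp, h]

/-- Here `R` is, up to sign, a nontrivial unipotent. In triangular form with off-diagonal entry `k ≠
0`, invariance kills the coefficients of `x ^ 6`, `x ^ 5 y` and `x ^ 4 y ^ 2` in turn. -/
theorem hasTripleRoot_of_comp_eq {p : Poly} (hp : p.IsHomogeneous 6)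
    {R : Matrix (Fin 2) (Fin 2) ℂ} (hR : comp p R = p) (hdet : R.det = 1) (h1 : R ≠ 1)
    (h2 : R ≠ -1) {x y l : ℂ} (hxy : ¬(x = 0 ∧ y = 0)) (hx : R 0 0 * x + R 0 1 * y = l * x)
    (hy : R 1 0 * x + R 1 1 * y = l * y) (hl : l ^ 2 = 1) : HasTripleRoot p := by
  have key : ∀ z z' : ℂ, x * z' - z * y ≠ 0 → HasTripleRoot p := by
    intro z z' hz
    set M : Matrix (Fin 2) (Fin 2) ℂ := !![x, z; y, z'] with hM
    have hMdet : M.det ≠ 0 := by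
      rw [hM, Matrix.det_fin_two]
      exact hz
    -- This is the upper right entry of `M⁻¹ * R * M`.
    set k : ℂ := ((R 0 0 * z + R 0 1 * z') * z' - z * (R 1 0 * z + R 1 1 * z')) / (x * z' - z * y)
      with hk
    have hl0 : l ≠ 0 := by
      rintro rfl
      simp at hl
    have hRM : R * M = M * !![l, k; 0, l] := by
      rw [Matrix.det_fin_two] at hdet
      have hkz : k * (x * z' - z * y) =
          (R 0 0 * z + R 0 1 * z') * z' - z * (R 1 0 * z + R 1 1 * z') := by
        exact div_mul_cancel₀ _ hz
      have hlast : x * (R 1 0 * z + R 1 1 * z') - y * (R 0 0 * z + R 0 1 * z') =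
          l * (x * z' - z * y) := by
        have : l * (x * (R 1 0 * z + R 1 1 * z') - y * (R 0 0 * z + R 0 1 * z') -
          l * (x * z' - z * y)) = 0 := by
          linear_combination (-(R 1 0 * z + R 1 1 * z')) * hx + (R 0 0 * z + R 0 1 * z') * hy +
            (x * z' - z * y) * hdet - (x * z' - z * y) * hl
        linear_combination (mul_eq_zero.1 this).resolve_left hl0
      ext i j
      fin_cases i <;> fin_cases j <;> simp [hM, Matrix.mul_apply, Fin.sum_univ_two]
      · linear_combination hx
      · refine mul_right_cancel₀ hz ?_
        linear_combination -x * hkz + z * hlast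
      · linear_combination hy
      · refine mul_right_cancel₀ hz ?_
        linear_combination -y * hkz + z' * hlast
    have hk0 : k ≠ 0 := by
      intro hk0
      have hRl : R = l • (1 : Matrix (Fin 2) (Fin 2) ℂ) := by
        have hu : IsUnit M := (Matrix.isUnit_iff_isUnit_det _).2 (isUnit_iff_ne_zero.2 hMdet)
        refine hu.mul_right_cancel ?_
        rw [hRM, hk0]
        ext i j
        fin_cases i <;> fin_cases j <;> simp [hM, Matrix.mul_apply, Fin.sum_univ_two] <;> ring
      rcases eq_or_eq_neg_of_sq_eq_sq l 1 (by simpa using hl) with rfl | rfl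
      · exact h1 (by simpa using hRl)
      · exact h2 (by simpa using hRl)
    have hinv := comp_conj_eq hR hRM
    obtain ⟨a, b, c, d, e, f, g, hq⟩ := IsHomogeneous.exists_sext (IsHomogeneous.comp hp M)
    refine ⟨M, hMdet, d, e, f, g, ?_⟩
    rw [hq, comp_sext_upper] at hinv
    obtain ⟨-, e1, e2, e3, -⟩ := sext_inj hinv
    have hl6 : l ^ 6 = 1 := by linear_combination (l ^ 4 + l ^ 2 + 1) * hl
    rw [hl6] at e1 e2 e3
    have ha : a = 0 := by
      have : l ^ 5 * k * a = 0 := by linear_combination e1 / 6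
      exact (mul_eq_zero.1 this).resolve_left (mul_ne_zero (pow_ne_zero _ hl0) hk0)
    subst ha
    have hb : b = 0 := by
      have : l ^ 5 * k * b = 0 := by linear_combination e2 / 5
      exact (mul_eq_zero.1 this).resolve_left (mul_ne_zero (pow_ne_zero _ hl0) hk0)
    subst hb
    have hc : c = 0 := by
      have : l ^ 5 * k * c = 0 := by linear_combination e3 / 4
      exact (mul_eq_zero.1 this).resolve_left (mul_ne_zero (pow_ne_zero _ hl0) hk0)
    rw [hq, hc]
  by_cases hx0 : x = 0
  · exact key 1 0 (by simpa [hx0] using fun hy0 => hxy ⟨hx0, hy0⟩)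
  · exact key 0 1 (by simpa using hx0)

theorem similar_B_of_comp_eq {p : Poly} {M : Matrix (Fin 2) (Fin 2) ℂ} (hM : M.det ≠ 0) {a d : ℂ}
    (ha : a ≠ 0) (h : comp p M = sext a 0 0 d 0 0 a) : ∃ t, Similar p (B t) := by
  obtain ⟨k, hk⟩ := IsAlgClosed.exists_pow_nat_eq a⁻¹ (n := 6) (by norm_num)
  have hk0 : k ≠ 0 := by
    rintro rfl
    exact inv_ne_zero ha (by rw [← hk]; simp)
  refine ⟨d * k ^ 6, Similar.trans ⟨M, hM, rfl⟩ ⟨!![k, 0; 0, k], by simpa using hk0, ?_⟩⟩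
  have hak : a * k ^ 6 = 1 := by rw [hk]; field_simp
  rw [h, comp_sext_diag, B_eq_sext, hak]
  congr 1 <;> ring

/-- A sextic form without triple root that is invariant under two different involutions is similar
to some `B t`, or else the two involutions anticommute and, in suitable coordinates, the form is
`x y (b x ^ 4 + d x ^ 2 y ^ 2 + b y ^ 4)`. -/
theorem pair_normal_form {p : Poly} (hp : p.IsHomogeneous 6) (htr : ¬HasTripleRoot p)
    {A A' : Matrix (Fin 2) (Fin 2) ℂ} (hA : A * A = 1) (hA' : A' * A' = 1) (hdet : A.det = -1)
    (hdet' : A'.det = -1) (h1 : A' ≠ A) (h2 : A' ≠ -A) (hpA : comp p A = p)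
    (hpA' : comp p A' = p) :
    (∃ t, Similar p (B t)) ∨ (A * A').trace = 0 ∧
      ∃ (M : Matrix (Fin 2) (Fin 2) ℂ) (l b d : ℂ), M.det ≠ 0 ∧ l ^ 2 = -1 ∧ b ≠ 0 ∧
        A * M = M * !![0, 1; 1, 0] ∧ A' * M = M * !![0, -l; l, 0] ∧
        comp p M = sext 0 b 0 d 0 b 0 := by
  set R := A * A' with hR
  have hRdet : R.det = 1 := by rw [hR, Matrix.det_mul, hdet, hdet']; norm_num
  have hpR : comp p R = p := by rw [hR, ← comp_comp, hpA, hpA']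
  have hAR : A * R = A' := by rw [hR, ← mul_assoc, hA, one_mul]
  have hR1 : R ≠ 1 := by
    intro h
    rw [h, mul_one] at hAR
    exact h1 hAR.symm
  have hR2 : R ≠ -1 := by
    intro h
    rw [h, mul_neg, mul_one] at hAR
    exact h2 hAR.symm
  -- The polynomial is the characteristic polynomial of `R`, whose determinant is 1.
  obtain ⟨l, hl⟩ := IsAlgClosed.exists_root
      (Polynomial.C 1 * Polynomial.X ^ 2 + Polynomial.C (-R.trace) * Polynomial.X +
        Polynomial.C (1 : ℂ)) (by rw [Polynomial.degree_quadratic one_ne_zero]; decide)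
  have hl' : l ^ 2 - R.trace * l + 1 = 0 := by
    simp [Polynomial.IsRoot] at hl
    linear_combination hl
  have hl0 : l ≠ 0 := by
    rintro rfl
    simp at hl'
  obtain ⟨e, he0, he⟩ := (Matrix.exists_mulVec_eq_zero_iff (M := R - l • 1)).2 (by
    rw [Matrix.det_fin_two] at hRdet ⊢
    rw [Matrix.trace_fin_two] at hl'
    simp
    linear_combination hRdet + hl')
  have hRe : R.mulVec e = l • e := by
    rw [Matrix.sub_mulVec, Matrix.smul_mulVec, Matrix.one_mulVec] at he
    exact sub_eq_zero.1 he
  have hRe0 : R 0 0 * e 0 + R 0 1 * e 1 = l * e 0 := by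
    simpa [Matrix.mulVec, dotProduct, Fin.sum_univ_two] using congrFun hRe 0
  have hRe1 : R 1 0 * e 0 + R 1 1 * e 1 = l * e 1 := by
    simpa [Matrix.mulVec, dotProduct, Fin.sum_univ_two] using congrFun hRe 1
  have hexy : ¬(e 0 = 0 ∧ e 1 = 0) := by
    rintro ⟨h, h'⟩
    apply he0
    ext i
    fin_cases i
    exacts [h, h']
  have hl2 : l ^ 2 ≠ 1 := fun hl2 =>
    htr (hasTripleRoot_of_comp_eq hp hpR hRdet hR1 hR2 hexy hRe0 hRe1 hl2)
  -- In the basis `e`, `A e` the involution `A` is the swap, and `A'` is antidiagonal with entries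
  -- `l⁻¹` and `l`.
  set f := A.mulVec e with hf
  have hAf : A.mulVec f = e := by rw [hf, Matrix.mulVec_mulVec, hA, Matrix.one_mulVec]
  have hA'e : A'.mulVec e = l • f := by
    rw [← hAR, ← Matrix.mulVec_mulVec, hRe, Matrix.mulVec_smul]
  have hA'f : A'.mulVec f = l⁻¹ • e := by
    have : A'.mulVec (l • f) = e := by
      rw [← hA'e, Matrix.mulVec_mulVec, hA', Matrix.one_mulVec]
    rw [← this, Matrix.mulVec_smul, smul_smul, inv_mul_cancel₀ hl0, one_smul]
  set M : Matrix (Fin 2) (Fin 2) ℂ := !![e 0, f 0; e 1, f 1] with hM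
  have hmul : ∀ (T : Matrix (Fin 2) (Fin 2) ℂ) (v : Fin 2 → ℂ) (i : Fin 2),
      T i 0 * v 0 + T i 1 * v 1 = T.mulVec v i := by
    intro T v i
    simp [Matrix.mulVec, dotProduct, Fin.sum_univ_two]
  have hAM : A * M = M * !![0, 1; 1, 0] := by
    ext i j
    fin_cases i <;> fin_cases j <;> simp [hM, Matrix.mul_apply, Fin.sum_univ_two, hmul, hAf, ← hf]
  have hA'M : A' * M = M * !![0, l⁻¹; l, 0] := by
    ext i j
    fin_cases i <;> fin_cases j <;>
      simp [hM, Matrix.mul_apply, Fin.sum_univ_two, hmul, hA'e, hA'f]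
    all_goals ring
  have hMdet : M.det ≠ 0 := by
    intro hM0
    rw [hM, Matrix.det_fin_two] at hM0
    simp at hM0
    -- The vectors `e` and `f` are eigenvectors of `R` for the distinct eigenvalues `l` and `l⁻¹`,
    -- hence independent.
    have hRf : R.mulVec f = l⁻¹ • f := by
      rw [hR, ← Matrix.mulVec_mulVec, hA'f, Matrix.mulVec_smul]
    have hll : l - l⁻¹ ≠ 0 := by
      intro h
      apply hl2
      field_simp at h
      linear_combination h
    have hzero : ∀ i, e i • f = f i • e → e i • f = 0 := by
      intro i hi
      have h := congrArg R.mulVec hi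
      rw [Matrix.mulVec_smul, Matrix.mulVec_smul, hRf, hRe, smul_comm, smul_comm (f i), ← hi,
        ← sub_eq_zero, ← sub_smul] at h
      refine (smul_eq_zero.1 h).resolve_left ?_
      rw [← neg_sub]
      exact neg_ne_zero.2 hll
    have hf0 : f ≠ 0 := by
      intro h
      rw [h, Matrix.mulVec_zero] at hAf
      exact he0 hAf.symm
    have h0 : e 0 • f = 0 := hzero 0 (by
      ext i
      fin_cases i <;> simp
      · ring
      · linear_combination hM0)
    have h1 : e 1 • f = 0 := hzero 1 (by
      ext i
      fin_cases i <;> simp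
      · linear_combination -hM0
      · ring)
    exact hexy ⟨(smul_eq_zero.1 h0).resolve_right hf0, (smul_eq_zero.1 h1).resolve_right hf0⟩
  have hinv := comp_conj_eq hpA hAM
  have hinv' := comp_conj_eq hpA' hA'M
  obtain ⟨a, b, c, d, e', f', g, hq⟩ := IsHomogeneous.exists_sext (IsHomogeneous.comp hp M)
  rw [hq, comp_sext_antidiag] at hinv hinv'
  obtain ⟨e1, e2, e3, -, -⟩ := sext_inj hinv
  obtain ⟨e1', e2', e3', -, -⟩ := sext_inj hinv'
  simp only [one_pow, mul_one] at e1 e2 e3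
  subst e1 e2 e3
  -- The swap has made the coefficients palindromic. Invariance under `A'` now says that the outer
  -- coefficient `g` vanishes unless `l ^ 6 = 1`, `f'` unless `l ^ 4 = 1`, and `e'` unless `l ^ 2 =
  -- 1`. Since `l ^ 2 ≠ 1`, `e'` is zero and `g`, `f'` are not both nonzero.
  field_simp at e1' e2' e3'
  have hc : e' = 0 := by
    have : (l ^ 2 - 1) * e' = 0 := by linear_combination e3'
    exact (mul_eq_zero.1 this).resolve_left (sub_ne_zero.2 hl2)
  subst hc
  by_cases ha : g = 0
  · subst ha
    by_cases hb : f' = 0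
    · subst hb
      exact absurd ⟨M, hMdet, _, _, _, _, hq⟩ htr
    · right
      have hl4 : l ^ 2 = -1 := by
        have : (l ^ 2 - 1) * (l ^ 2 + 1) * f' = 0 := by linear_combination e2'
        have := (mul_eq_zero.1 ((mul_eq_zero.1 this).resolve_right hb)).resolve_left
          (sub_ne_zero.2 hl2)
        linear_combination this
      have hinvl : l⁻¹ = -l := by
        field_simp
        linear_combination hl4
      rw [hinvl] at hA'M
      refine ⟨?_, M, l, f', d, hMdet, hl4, hb, hAM, hA'M, hq⟩
      have : l * R.trace = 0 := by linear_combination hl4 - hl'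
      exact (mul_eq_zero.1 this).resolve_left hl0
  · left
    have hb : f' = 0 := by
      have h4 : (l ^ 2 - 1) * (l ^ 2 + 1) * f' = 0 := by linear_combination e2'
      have h6 : (l ^ 2 - 1) * ((l ^ 4 + l ^ 2 + 1) * g) = 0 := by linear_combination e1'
      have h6' := (mul_eq_zero.1 ((mul_eq_zero.1 h6).resolve_left
        (sub_ne_zero.2 hl2))).resolve_right ha
      refine (mul_eq_zero.1 h4).resolve_left (mul_ne_zero (sub_ne_zero.2 hl2) ?_)
      intro h
      have : (1 : ℂ) = 0 := by linear_combination h6' - l ^ 2 * h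
      exact one_ne_zero this
    subst hb
    exact similar_B_of_comp_eq hMdet ha hq

theorem mirror_mul_self {u v w : ℂ} (h : u ^ 2 + v * w = 1) : mirror u v w * mirror u v w = 1 := by
  ext i j
  fin_cases i <;> fin_cases j <;> simp [mirror, Matrix.mul_apply, Fin.sum_univ_two]
  · linear_combination h
  · ring
  · ring
  · linear_combination h

theorem det_mirror {u v w : ℂ} (h : u ^ 2 + v * w = 1) : (mirror u v w).det = -1 := by
  rw [mirror, Matrix.det_fin_two]
  simp
  linear_combination -h

theorem mirror_neg (u v w : ℂ) : mirror (-u) (-v) (-w) = -mirror u v w := by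
  ext i j
  fin_cases i <;> fin_cases j <;> simp [mirror]

/-- Different representations are fixed by different involutions, even up to sign. -/
theorem FixedBy.mirror_ne {p : Poly} {u v w u' v' w' : ℂ} {s s' : Sym2 Poly}
    (h1 : u ^ 2 + v * w = 1) (h : FixedBy p u v w s) (h' : FixedBy p u' v' w' s') (hs : s' ≠ s) :
    mirror u' v' w' ≠ mirror u v w ∧ mirror u' v' w' ≠ -mirror u v w := by
  have h0 : ¬(u = 0 ∧ v = 0 ∧ w = 0) := by
    rintro ⟨rfl, rfl, rfl⟩
    simp at h1
  have key : ∀ u v w : ℂ, ¬(u = 0 ∧ v = 0 ∧ w = 0) → FixedBy p u v w s →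
      mirror u' v' w' ≠ mirror u v w := by
    intro u v w h0 h hm
    have e0 := congrFun (congrFun hm 0) 0
    have e1 := congrFun (congrFun hm 0) 1
    have e2 := congrFun (congrFun hm 1) 0
    simp [mirror] at e0 e1 e2
    subst e0 e1 e2
    exact hs (h.unique h0 h')
  refine ⟨key u v w h0 h, ?_⟩
  rw [← mirror_neg]
  exact key _ _ _ (by simpa using h0) h.neg

theorem exists_similar_B_of_three_representations {p : Poly} (hp : p.IsHomogeneous 6)
    {s₁ s₂ s₃ : Sym2 Poly} (hs₁ : s₁ ∈ representations p) (hs₂ : s₂ ∈ representations p)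
    (hs₃ : s₃ ∈ representations p) (h₁₂ : s₁ ≠ s₂) (h₁₃ : s₁ ≠ s₃) (h₂₃ : s₂ ≠ s₃) :
    ∃ t, Similar p (B t) := by
  have htr : ¬HasTripleRoot p := fun h => h₁₂ (h.representations_subsingleton hs₁ hs₂)
  obtain ⟨u₁, v₁, w₁, hn₁, hf₁⟩ := exists_fixedBy htr hs₁
  obtain ⟨u₂, v₂, w₂, hn₂, hf₂⟩ := exists_fixedBy htr hs₂
  obtain ⟨u₃, v₃, w₃, hn₃, hf₃⟩ := exists_fixedBy htr hs₃
  have key : ∀ {u v w u' v' w' : ℂ} {s s' : Sym2 Poly} (_ : u ^ 2 + v * w = 1)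
      (_ : u' ^ 2 + v' * w' = 1) (_ : FixedBy p u v w s) (_ : FixedBy p u' v' w' s') (_ : s ≠ s'),
      _ := fun {u v w u' v' w' s s'} h1 h1' h h' hs =>
    pair_normal_form hp htr (mirror_mul_self h1) (mirror_mul_self h1') (det_mirror h1)
      (det_mirror h1') (h.mirror_ne h1 h' hs.symm).1 (h.mirror_ne h1 h' hs.symm).2 (h.comp_eq h1)
      (h'.comp_eq h1')
  rcases key hn₁ hn₃ hf₁ hf₃ h₁₃ with h | ⟨ht₁, -⟩
  · exact h
  rcases key hn₂ hn₃ hf₂ hf₃ h₂₃ with h | ⟨ht₂, -⟩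
  · exact h
  rcases key hn₁ hn₂ hf₁ hf₂ h₁₂ with h | ⟨-, M, l, b, d, hM, hl, hb, hM₁, hM₂, hq⟩
  · exact h
  exfalso
  have hl0 : l ≠ 0 := by
    rintro rfl
    simp at hl
  have hMu : IsUnit M.det := isUnit_iff_ne_zero.2 hM
  set T := M⁻¹ * mirror u₃ v₃ w₃ * M with hT
  have hMT : mirror u₃ v₃ w₃ * M = M * T := by
    rw [hT, ← mul_assoc, ← mul_assoc, Matrix.mul_nonsing_inv _ hMu, one_mul]
  have htrace : ∀ A A' : Matrix (Fin 2) (Fin 2) ℂ, A * M = M * A' → A.trace = A'.trace := by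
    intro A A' h
    have : A' = M⁻¹ * (A * M) := by
      rw [h, ← mul_assoc, Matrix.nonsing_inv_mul _ hMu, one_mul]
    rw [this, Matrix.trace_mul_comm, mul_assoc, Matrix.mul_nonsing_inv _ hMu, mul_one]
  have hprod : ∀ A A' : Matrix (Fin 2) (Fin 2) ℂ, A * M = M * A' →
      A * mirror u₃ v₃ w₃ * M = M * (A' * T) := by
    intro A A' h
    rw [mul_assoc, hMT, ← mul_assoc, h, mul_assoc]
  rw [htrace _ _ (hprod _ _ hM₁)] at ht₁
  rw [htrace _ _ (hprod _ _ hM₂)] at ht₂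
  have ht₃ : T.trace = 0 := by
    rw [← htrace _ _ hMT, Matrix.trace_fin_two]
    simp [mirror]
  simp [Matrix.trace_fin_two, Matrix.vecMul, dotProduct, Fin.sum_univ_two] at ht₁ ht₂ ht₃
  -- Trace zero against both antidiagonal involutions forces `T` to be diagonal, with entries `±1`
  -- and `∓1`. Such a `T` negates the coefficient `b` of `x ^ 5 y`.
  have h10 : T 1 0 = 0 := by
    have : 2 * l * T 1 0 = 0 := by linear_combination l * ht₁ - ht₂
    exact (mul_eq_zero.1 this).resolve_left (mul_ne_zero two_ne_zero hl0)
  have h01 : T 0 1 = 0 := by linear_combination ht₁ - h10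
  have hTeq : T = !![T 0 0, 0; 0, -T 0 0] := by
    ext i j
    fin_cases i <;> fin_cases j <;> simp
    · exact h01
    · exact h10
    · linear_combination ht₃
  have hTT : T * T = 1 := by
    rw [hT, mul_assoc, ← mul_assoc M, ← mul_assoc M, Matrix.mul_nonsing_inv _ hMu, one_mul,
      ← mul_assoc, mul_assoc M⁻¹, mirror_mul_self hn₃, mul_one, Matrix.nonsing_inv_mul _ hMu]
  have h00 : T 0 0 ^ 2 = 1 := by
    have := congrFun (congrFun hTT 0) 0
    rw [Matrix.mul_apply, Fin.sum_univ_two, h01] at this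
    simp at this
    linear_combination this
  have hinv := comp_conj_eq (hf₃.comp_eq hn₃) hMT
  rw [hTeq, hq, comp_sext_diag] at hinv
  obtain ⟨-, e1, -⟩ := sext_inj hinv
  apply hb
  linear_combination (-1 / 2 : ℂ) * e1 - b / 2 * (T 0 0 ^ 4 + T 0 0 ^ 2 + 1) * h00

/-! ### The involutions that fix `B t`. -/

/-- The image is `(l x + m y) ^ 3` times a cubic with coefficients `c₀, …, c₃`. -/
theorem comp_sext_triple (d e f g x y l m : ℂ) : ∃ c₀ c₁ c₂ c₃,
    comp (sext 0 0 0 d e f g) !![x, y; l, m] =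
      sext (l ^ 3 * c₀) (3 * l ^ 2 * m * c₀ + l ^ 3 * c₁)
        (3 * l * m ^ 2 * c₀ + 3 * l ^ 2 * m * c₁ + l ^ 3 * c₂)
        (m ^ 3 * c₀ + 3 * l * m ^ 2 * c₁ + 3 * l ^ 2 * m * c₂ + l ^ 3 * c₃)
        (m ^ 3 * c₁ + 3 * l * m ^ 2 * c₂ + 3 * l ^ 2 * m * c₃)
        (m ^ 3 * c₂ + 3 * l * m ^ 2 * c₃) (m ^ 3 * c₃) := by
  refine ⟨d * x ^ 3 + e * x ^ 2 * l + f * x * l ^ 2 + g * l ^ 3,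
    3 * d * x ^ 2 * y + e * (x ^ 2 * m + 2 * x * y * l) + f * (2 * x * l * m + y * l ^ 2) +
      3 * g * l ^ 2 * m,
    3 * d * x * y ^ 2 + e * (y ^ 2 * l + 2 * x * y * m) + f * (2 * y * l * m + x * m ^ 2) +
      3 * g * l * m ^ 2,
    d * y ^ 3 + e * y ^ 2 * m + f * y * m ^ 2 + g * m ^ 3, ?_⟩
  simp [sext, comp_add, comp_mul, comp_pow, comp_C, comp_X]
  simp only [map_ofNat]
  ring

/-- The four vanishing coefficients already overdetermine the cubic cofactor of `(l x + m y) ^ 3`,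
so the coefficient `t` plays no role. -/
theorem not_hasTripleRoot_B (t : ℂ) : ¬HasTripleRoot (B t) := by
  rintro ⟨M, hM, d, e, f, g, h⟩
  have h' := comp_comp_inv (B t) hM
  rw [h, Matrix.eta_fin_two M⁻¹] at h'
  obtain ⟨c₀, c₁, c₂, c₃, hc⟩ :=
    comp_sext_triple d e f g (M⁻¹ 0 0) (M⁻¹ 0 1) (M⁻¹ 1 0) (M⁻¹ 1 1)
  rw [hc, B_eq_sext] at h'
  generalize M⁻¹ 1 0 = l at h'
  generalize M⁻¹ 1 1 = m at h'
  obtain ⟨h0, h1, h2, -, h4, h5, h6⟩ := sext_inj h'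
  have hl : l ≠ 0 := by
    rintro rfl
    simp at h0
  have hm : m ≠ 0 := by
    rintro rfl
    simp at h6
  have hc0 : c₀ ≠ 0 := by
    rintro rfl
    simp at h0
  have e1 : l * c₁ = -3 * m * c₀ := by
    refine mul_left_cancel₀ (pow_ne_zero 2 hl) ?_
    linear_combination h1
  have e2 : l ^ 2 * c₂ = 6 * m ^ 2 * c₀ := by
    refine mul_left_cancel₀ hl ?_
    linear_combination h2 - 3 * l * m * e1
  have e3 : l ^ 3 * c₃ = -2 * m ^ 3 * c₀ := by
    refine mul_left_cancel₀ (pow_ne_zero 2 hm) ?_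
    linear_combination l ^ 2 / 3 * h5 - m ^ 3 / 3 * e2
  have e4 : 9 * m ^ 4 * c₀ = 0 := by
    linear_combination l * h4 - m ^ 3 * e1 - 3 * m ^ 2 * e2 - 3 * m * e3
  simp [hm, hc0] at e4

theorem comp_B_mirror (t u v w : ℂ) : comp (B t) (mirror u v w) =
    sext (u ^ 6 + t * u ^ 3 * w ^ 3 + w ^ 6)
      (6 * u ^ 5 * v + 3 * t * (u ^ 2 * v * w ^ 3 - u ^ 4 * w ^ 2) - 6 * u * w ^ 5)
      (15 * u ^ 4 * v ^ 2 + t * (3 * u * v ^ 2 * w ^ 3 - 9 * u ^ 3 * v * w ^ 2 + 3 * u ^ 5 * w) +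
        15 * u ^ 2 * w ^ 4)
      (20 * u ^ 3 * v ^ 3 + t * (v ^ 3 * w ^ 3 - 9 * u ^ 2 * v ^ 2 * w ^ 2 + 9 * u ^ 4 * v * w -
        u ^ 6) - 20 * u ^ 3 * w ^ 3)
      (15 * u ^ 2 * v ^ 4 + t * (-3 * u * v ^ 3 * w ^ 2 + 9 * u ^ 3 * v ^ 2 * w - 3 * u ^ 5 * v) +
        15 * u ^ 4 * w ^ 2)
      (6 * u * v ^ 5 + 3 * t * (u ^ 2 * v ^ 3 * w - u ^ 4 * v ^ 2) - 6 * u ^ 5 * w)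
      (v ^ 6 - t * u ^ 3 * v ^ 3 + u ^ 6) := by
  simp [B, mirror, sext, comp_add, comp_mul, comp_pow, comp_C, comp_X]
  simp only [map_ofNat]
  ring

/-- The involutions that fix `B t`. -/
theorem mirror_of_comp_B_eq {t u v w : ℂ} (hn : u ^ 2 + v * w = 1)
    (h : comp (B t) (mirror u v w) = B t) :
    (u = 0 ∧ w ^ 6 = 1) ∨ (t = 0 ∧ v = 0 ∧ w = 0) ∨
      (t ^ 2 = -50 ∧ u ^ 2 = 2 / 3 ∧ t * u * w ^ 3 = 10 / 9) := by
  rw [comp_B_mirror, B_eq_sext] at h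
  obtain ⟨h0, h1, -, h3, -, h5, h6⟩ := sext_inj h
  by_cases hu : u = 0
  · subst hu
    left
    exact ⟨rfl, by linear_combination h0⟩
  right
  have e1 : 2 * u ^ 4 * v + t * (u * v * w ^ 3 - u ^ 3 * w ^ 2) - 2 * w ^ 5 = 0 := by
    refine (mul_eq_zero.1 ?_).resolve_left hu
    linear_combination h1 / 3
  have e5 : 2 * v ^ 5 + t * (u * v ^ 3 * w - u ^ 3 * v ^ 2) - 2 * u ^ 4 * w = 0 := by
    refine (mul_eq_zero.1 ?_).resolve_left hu
    linear_combination h5 / 3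
  -- `E1` to `E4` express `t u w ^ 3`, `t u v ^ 3`, `w ^ 6` and `v ^ 6` through `u ^ 2`. Computing
  -- `4 (1 - u ^ 4) ^ 2` both as the square of `t u w ^ 3` and as a product with `v ^ 3 w ^ 3 = (1 -
  -- u ^ 2) ^ 3` gives `P1` and `P2`; their difference factors.
  have E1 : t * u * w ^ 3 = 2 * (1 - u ^ 4) := by
    linear_combination w * e1 + 2 * h0 - (2 * u ^ 4 + t * u * w ^ 3) * hn
  have E2 : -(t * u * v ^ 3) = 2 * (1 - u ^ 4) := by
    linear_combination -v * e5 + 2 * h6 - (2 * u ^ 4 - t * u * v ^ 3) * hn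
  have E3 : w ^ 6 = 1 - 2 * u ^ 2 + u ^ 6 := by linear_combination h0 - u ^ 2 * E1
  have E4 : v ^ 6 = 1 - 2 * u ^ 2 + u ^ 6 := by linear_combination h6 - u ^ 2 * E2
  have hvw : v * w = 1 - u ^ 2 := by linear_combination hn
  have P1 : t ^ 2 * u ^ 2 * (1 - 2 * u ^ 2 + u ^ 6) = 4 * (1 - u ^ 4) ^ 2 := by
    rw [← E3]
    linear_combination (t * u * w ^ 3 + 2 * (1 - u ^ 4)) * E1
  have P2 : -(t ^ 2 * u ^ 2 * (1 - u ^ 2) ^ 3) = 4 * (1 - u ^ 4) ^ 2 := by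
    rw [← hvw]
    linear_combination -(t * u * v ^ 3) * E1 + 2 * (1 - u ^ 4) * E2
  have hfac : t ^ 2 * u ^ 2 * ((1 - u ^ 2) * (2 - 3 * u ^ 2)) = 0 := by
    linear_combination P1 - P2
  have hone : u ^ 2 = 1 → t = 0 ∧ v = 0 ∧ w = 0 := by
    intro h1
    have hw : w = 0 := by
      refine pow_eq_zero_iff (n := 6) (by norm_num) |>.1 ?_
      rw [E3]
      linear_combination (u ^ 4 + u ^ 2 - 1) * h1
    have hv : v = 0 := by
      refine pow_eq_zero_iff (n := 6) (by norm_num) |>.1 ?_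
      rw [E4]
      linear_combination (u ^ 4 + u ^ 2 - 1) * h1
    refine ⟨?_, hv, hw⟩
    rw [hv, hw] at h3
    linear_combination (-1 / 2 : ℂ) * h3 - t / 2 * (u ^ 4 + u ^ 2 + 1) * h1
  rcases mul_eq_zero.1 hfac with h' | h'
  · have ht : t = 0 := by
      have := (mul_eq_zero.1 h').resolve_right (pow_ne_zero 2 hu)
      exact pow_eq_zero_iff (n := 2) (by norm_num) |>.1 this
    left
    subst ht
    have hX : (u ^ 2 - 1) * (u ^ 2 + 1) = 0 := by linear_combination E1 / 2
    rcases mul_eq_zero.1 hX with hX | hX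
    · exact hone (sub_eq_zero.1 hX)
    · exfalso
      have hX' : u ^ 2 = -1 := by linear_combination hX
      have hu6 : u ^ 6 = -1 := by
        rw [show u ^ 6 = (u ^ 2) ^ 3 by ring, hX']
        norm_num
      have h64 : (v * w) ^ 6 = v ^ 6 * w ^ 6 := mul_pow _ _ _
      rw [E3, E4, hvw, hu6, hX'] at h64
      norm_num at h64
  · rcases mul_eq_zero.1 h' with h' | h'
    · exact Or.inl (hone (by linear_combination -h'))
    · right
      have hX : u ^ 2 = 2 / 3 := by linear_combination -h' / 3
      have hX4 : u ^ 4 = 4 / 9 := by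
        rw [show u ^ 4 = (u ^ 2) ^ 2 by ring, hX]
        norm_num
      rw [hX, hX4] at P2
      refine ⟨by linear_combination -(81 / 2) * P2, hX, ?_⟩
      rw [E1, hX4]
      norm_num

/-! ### Representations of `B t` attached to its involutions. -/

theorem linearIndependent_quad {a b c a' b' c' : ℂ}
    (h : a * b' - a' * b ≠ 0 ∨ a * c' - a' * c ≠ 0) :
    LinearIndependent ℂ ![quad a b c, quad a' b' c'] := by
  rw [LinearIndependent.pair_iff]
  intro r r' hr
  rw [smul_quad, smul_quad, quad_add_quad, ← quad_zero] at hr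
  obtain ⟨h0, h1, h2⟩ := quad_inj hr
  rcases h with h | h
  · constructor <;> refine (mul_eq_zero.1 ?_).resolve_right h
    · linear_combination b' * h0 - a' * h1
    · linear_combination -b * h0 + a * h1
  · constructor <;> refine (mul_eq_zero.1 ?_).resolve_right h
    · linear_combination c' * h0 - a' * h2
    · linear_combination -c * h0 + a * h2

theorem sum_cubes_eq_B {a b c a' b' c' t : ℂ} (h0 : a ^ 3 + a' ^ 3 = 1)
    (h1 : a ^ 2 * b + a' ^ 2 * b' = 0)
    (h2 : a ^ 2 * c + a * b ^ 2 + (a' ^ 2 * c' + a' * b' ^ 2) = 0)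
    (h3 : 6 * a * b * c + b ^ 3 + (6 * a' * b' * c' + b' ^ 3) = t)
    (h4 : a * c ^ 2 + b ^ 2 * c + (a' * c' ^ 2 + b' ^ 2 * c') = 0)
    (h5 : b * c ^ 2 + b' * c' ^ 2 = 0) (h6 : c ^ 3 + c' ^ 3 = 1) :
    quad a b c ^ 3 + quad a' b' c' ^ 3 = B t := by
  rw [quad_pow_three, quad_pow_three, sext_add_sext, B_eq_sext]
  congr 1
  · linear_combination 3 * h1
  · linear_combination 3 * h2
  · linear_combination 3 * h4
  · linear_combination 3 * h5

theorem exists_fixedBy_dihedral {t k : ℂ} (hk : k ^ 3 = 1) (ht : t ^ 2 ≠ 4) :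
    ∃ s, FixedBy (B t) 0 k (k ^ 2) s := by
  have hk0 : k ≠ 0 := by
    rintro rfl
    simp at hk
  -- With `Q = k x ^ 2 + y ^ 2` and `m = x y`, one has `B t = Q ^ 3 - 3 k Q m ^ 2 + t m ^ 3`. The
  -- two cubes are those of multiples of `Q - r m` and `Q - q m`, the factors of the Hessian of this
  -- cubic; `r` and `q` are distinct because `t ^ 2 ≠ 4`.
  obtain ⟨r, hr⟩ := IsAlgClosed.exists_root
      (Polynomial.C 1 * Polynomial.X ^ 2 + Polynomial.C (-(t * k ^ 2)) * Polynomial.X +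
        Polynomial.C k) (by rw [Polynomial.degree_quadratic one_ne_zero]; decide)
  have hr : r ^ 2 - t * k ^ 2 * r + k = 0 := by
    simp [Polynomial.IsRoot] at hr
    linear_combination hr
  obtain ⟨q, hq⟩ : ∃ q, q = t * k ^ 2 - r := ⟨_, rfl⟩
  have hsum : r + q = t * k ^ 2 := by rw [hq]; ring
  have hprod : r * q = k := by rw [hq]; linear_combination -hr
  have hr0 : r ≠ 0 := by
    rintro rfl
    exact hk0 (by rw [← hprod, zero_mul])
  have hq0 : q ≠ 0 := by
    rintro rfl
    exact hk0 (by rw [← hprod, mul_zero])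
  have hd : q - r ≠ 0 := by
    intro hd
    apply ht
    have : k * (t ^ 2 - 4) = 0 := by
      linear_combination (q - r) * hd + 4 * hprod - (r + q + t * k ^ 2) * hsum -
        t ^ 2 * k * hk
    linear_combination (mul_eq_zero.1 this).resolve_left hk0
  -- The weights `α ^ 3`, `β ^ 3` solve `α ^ 3 + β ^ 3 = 1` and `α ^ 3 r + β ^ 3 q = 0`.
  obtain ⟨α, hα⟩ := IsAlgClosed.exists_pow_nat_eq (q / (q - r)) (n := 3) (by norm_num)
  obtain ⟨β, hβ⟩ := IsAlgClosed.exists_pow_nat_eq (-r / (q - r)) (n := 3) (by norm_num)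
  have hα0 : α ≠ 0 := by
    rintro rfl
    have : q / (q - r) ≠ 0 := div_ne_zero hq0 hd
    exact this (by rw [← hα]; simp)
  have hβ0 : β ≠ 0 := by
    rintro rfl
    have : -r / (q - r) ≠ 0 := div_ne_zero (neg_ne_zero.2 hr0) hd
    exact this (by rw [← hβ]; simp)
  have e0 : α ^ 3 + β ^ 3 = 1 := by
    rw [hα, hβ]
    field_simp
    ring
  have e1 : α ^ 3 * r + β ^ 3 * q = 0 := by
    rw [hα, hβ]
    field_simp
    ring
  have e2 : α ^ 3 * r ^ 2 + β ^ 3 * q ^ 2 = -k := by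
    linear_combination (r + q) * e1 - r * q * e0 - hprod
  have e3 : α ^ 3 * r ^ 3 + β ^ 3 * q ^ 3 = -t := by
    linear_combination (r + q) * e2 - r * q * e1 - k * hsum - t * hk
  refine ⟨_, k * α, -(α * r), α, k * β, -(β * q), β, linearIndependent_quad (Or.inl ?_),
    sum_cubes_eq_B ?_ ?_ ?_ ?_ ?_ ?_ e0, rfl, by ring, by ring⟩
  · have : k * α * -(β * q) - k * β * -(α * r) = -(k * α * β * (q - r)) := by ring
    rw [this]
    exact neg_ne_zero.2 (mul_ne_zero (mul_ne_zero (mul_ne_zero hk0 hα0) hβ0) hd)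
  · linear_combination (α ^ 3 + β ^ 3) * hk + e0
  · linear_combination -k ^ 2 * e1
  · linear_combination k ^ 2 * e0 + k * e2
  · linear_combination -6 * k * e1 - e3
  · linear_combination k * e0 + e2
  · linear_combination -e1

theorem exists_fixedBy_octahedral {t : ℂ} (ht : t ^ 2 = -50) :
    ∃ u h : ℂ, u ≠ 0 ∧ h ^ 2 = -1 / 3 ∧ u ^ 2 = 2 / 3 ∧ t * u * (-h) ^ 3 = 10 / 9 ∧
      ∀ k : ℂ, k ^ 3 = 1 → ∃ s, FixedBy (B t) u (h * k ^ 2) (-h * k) s := by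
  obtain ⟨h, hh⟩ := IsAlgClosed.exists_pow_nat_eq (-1 / 3 : ℂ) (n := 2) (by norm_num)
  obtain ⟨i, hi⟩ : ∃ i : ℂ, i ^ 2 = -1 := ⟨Complex.I, Complex.I_sq⟩
  -- For `k = 1` the forms sought are `a (x ^ 2 + b x y + i y ^ 2)` and `a (i x ^ 2 + b x y + y ^
  -- 2)`. The `x ^ 6` coefficient requires `a ^ 3 = (1 + i) / 2`, that of `x ^ 4 y ^ 2` requires `b
  -- ^ 2 = -i`, and that of `x ^ 3 y ^ 3` requires `t = 5 b (i - 1)`.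
  obtain ⟨a, ha⟩ := IsAlgClosed.exists_pow_nat_eq ((1 + i) / 2) (n := 3) (by norm_num)
  obtain ⟨b, hb⟩ : ∃ b, b = -t * (1 + i) / 10 := ⟨_, rfl⟩
  have hb2 : b ^ 2 = -i := by
    rw [hb]
    linear_combination (1 + i) ^ 2 / 100 * ht - hi / 2
  have htb : t = 5 * b * (i - 1) := by
    rw [hb]
    linear_combination t / 2 * hi
  have hi0 : i ≠ 0 := by
    rintro rfl
    simp at hi
  have hb0 : b ≠ 0 := by
    rintro rfl
    simp at hb2
    exact hi0 hb2
  have hi1 : 1 + i ≠ 0 := by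
    intro h
    have : (2 : ℂ) = 0 := by linear_combination (1 - i) * h + hi
    exact two_ne_zero this
  have hi2 : 1 - i ≠ 0 := by
    intro h
    have : (2 : ℂ) = 0 := by linear_combination (1 + i) * h + hi
    exact two_ne_zero this
  have ha0 : a ≠ 0 := by
    rintro rfl
    have : (1 + i) / 2 ≠ 0 := div_ne_zero hi1 two_ne_zero
    exact this (by rw [← ha]; simp)
  have hh0 : h ≠ 0 := by
    rintro rfl
    norm_num at hh
  -- This is the condition that both forms for `k = 1` be orthogonal to the normal `(u, h, -h)`.
  obtain ⟨u, hu⟩ : ∃ u, u * b = h * (1 + i) := ⟨h * (1 + i) / b, by field_simp⟩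
  have hu2 : u ^ 2 = 2 / 3 := by
    have : -i * u ^ 2 = -i * (2 / 3) := by
      rw [← hb2]
      linear_combination (u * b + h * (1 + i)) * hu + (1 + i) ^ 2 * hh - hi / 3 - 2 / 3 * hb2
    exact mul_left_cancel₀ (neg_ne_zero.2 hi0) this
  have hu0 : u ≠ 0 := by
    rintro rfl
    norm_num at hu2
  refine ⟨u, h, hu0, hh, hu2, ?_, ?_⟩
  · rw [htb]
    linear_combination -5 * (i - 1) * h ^ 3 * hu - 5 * h ^ 4 * hi + 10 * (h ^ 2 - 1 / 3) * hh
  · intro k hk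
    have hk0 : k ≠ 0 := by
      rintro rfl
      simp at hk
    -- The substitution `x ↦ k x` preserves `B t` and carries the representation for `k = 1` to this
    -- one.
    refine ⟨_, a * k ^ 2, a * (b * k), a * i, a * (i * k ^ 2), a * (b * k), a * 1,
      linearIndependent_quad (Or.inl ?_), sum_cubes_eq_B ?_ ?_ ?_ ?_ ?_ ?_ ?_, rfl, ?_, ?_⟩
    · have : a * k ^ 2 * (a * (b * k)) - a * (i * k ^ 2) * (a * (b * k)) =
        a ^ 2 * b * k ^ 3 * (1 - i) := by ring
      rw [this]
      exact mul_ne_zero (mul_ne_zero (mul_ne_zero (pow_ne_zero 2 ha0) hb0) (pow_ne_zero 3 hk0)) hi2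
    · linear_combination (1 + i ^ 3) * k ^ 6 * ha + (1 + i ^ 3) * (1 + i) / 2 * (k ^ 3 + 1) * hk +
        (1 + i) * i / 2 * hi - hi / 2
    · linear_combination a ^ 3 * b * k ^ 5 * hi
    · linear_combination a ^ 3 * k ^ 4 * (1 + i) * hb2
    · rw [htb]
      linear_combination (12 * i * b + 2 * b ^ 3) * a ^ 3 * hk + (12 * i * b + 2 * b ^ 3) * ha +
        b * (1 + i) * hb2 + 5 * b * hi
    · linear_combination a ^ 3 * k ^ 2 * (1 + i) * hb2
    · linear_combination a ^ 3 * b * k * hi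
    · linear_combination (1 + i ^ 3) * ha + (1 + i) * i / 2 * hi - hi / 2
    · refine mul_left_cancel₀ hb0 ?_
      linear_combination -a * b * k * hu + a * b * k * h * hk
    · refine mul_left_cancel₀ hb0 ?_
      linear_combination -a * b * k * hu + a * b * i * k * h * hk

/-! ### Counting the representations of `B t`. -/

/-- If a finite list of involutions exhausts those fixing `B t` up to sign, without repetition, and
each of them comes from a representation, then it counts the representations. -/
theorem N_B_eq_card {ι : Type*} [Finite ι] {t : ℂ} {u v w : ι → ℂ} {s : ι → Sym2 Poly}
    (hn : ∀ i, u i ^ 2 + v i * w i = 1) (hs : ∀ i, FixedBy (B t) (u i) (v i) (w i) (s i))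
    (hinj : ∀ i j, (u j = u i ∧ v j = v i ∧ w j = w i) ∨ (u j = -u i ∧ v j = -v i ∧ w j = -w i) →
      i = j)
    (hall : ∀ a b c, a ^ 2 + b * c = 1 → comp (B t) (mirror a b c) = B t →
      ∃ i, (a = u i ∧ b = v i ∧ c = w i) ∨ (a = -u i ∧ b = -v i ∧ c = -w i)) :
    N (B t) = Nat.card ι := by
  have hsinj : Function.Injective s := fun i j hij =>
    hinj i j (FixedBy.eq_or_eq_neg (hn i) (hn j) (hs i) (hij ▸ hs j))
  have hrange : representations (B t) = s '' Set.univ := by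
    rw [Set.image_univ]
    refine Set.Subset.antisymm ?_ ?_
    · intro r hr
      obtain ⟨a, b, c, habc, hr'⟩ := exists_fixedBy (not_hasTripleRoot_B t) hr
      have h0 : ∀ i, ¬(u i = 0 ∧ v i = 0 ∧ w i = 0) := by
        rintro i ⟨h1, h2, h3⟩
        have := hn i
        rw [h1, h2, h3] at this
        simp at this
      obtain ⟨i, ⟨rfl, rfl, rfl⟩ | ⟨rfl, rfl, rfl⟩⟩ := hall a b c habc (hr'.comp_eq habc)
      · exact ⟨i, (FixedBy.unique (h0 i) hr' (hs i))⟩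
      · refine ⟨i, FixedBy.unique ?_ hr' (hs i).neg⟩
        simpa using h0 i
    · rintro _ ⟨i, rfl⟩
      exact (hs i).mem
  rw [N, hrange, hsinj.encard_image, Set.encard_univ, ENat.card_eq_coe_natCard]

/-- A cube root of unity as a complex number. -/
def root (i : rootsOfUnity 3 ℂ) : ℂ := ((i : ℂˣ) : ℂ)

theorem root_pow_three (i : rootsOfUnity 3 ℂ) : root i ^ 3 = 1 := by
  have := (mem_rootsOfUnity' 3 (i : ℂˣ)).1 i.2
  exact this

theorem root_injective : Function.Injective root := fun _ _ h => Subtype.ext (Units.ext h)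

theorem exists_root_eq {k : ℂ} (hk : k ^ 3 = 1) : ∃ i, root i = k :=
  ⟨rootsOfUnity.mkOfPowEq k hk, rootsOfUnity.coe_mkOfPowEq hk⟩

theorem root_eq_of_eq_or_eq_neg {i j : rootsOfUnity 3 ℂ} (h : root j = root i ∨ root j = -root i) :
    i = j := by
  rcases h with h | h
  · exact root_injective h.symm
  · exfalso
    have h1 := root_pow_three j
    rw [h] at h1
    have : (2 : ℂ) = 0 := by linear_combination -h1 - root_pow_three i
    exact two_ne_zero this

theorem card_rootsOfUnity_three : Nat.card (rootsOfUnity 3 ℂ) = 3 :=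
  Complex.card_rootsOfUnity 3

theorem eq_dihedral {b c : ℂ} (hbc : b * c = 1) (hc : c ^ 6 = 1) : ∃ i,
    (b = root i ∧ c = root i ^ 2) ∨ (b = -root i ∧ c = -root i ^ 2) := by
  have hb : b ^ 6 = 1 := by
    have h : b ^ 6 * c ^ 6 = 1 := by rw [← mul_pow, hbc, one_pow]
    rwa [hc, mul_one] at h
  have : (b ^ 3 - 1) * (b ^ 3 + 1) = 0 := by linear_combination hb
  have hb0 : b ≠ 0 := by
    rintro rfl
    simp at hb
  rcases mul_eq_zero.1 this with h | h
  · obtain ⟨i, hi⟩ := exists_root_eq (k := b) (by linear_combination h)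
    refine ⟨i, Or.inl ⟨hi.symm, mul_left_cancel₀ hb0 ?_⟩⟩
    rw [hi]
    linear_combination hbc - h
  · obtain ⟨i, hi⟩ := exists_root_eq (k := -b) (by linear_combination -h)
    refine ⟨i, Or.inr ⟨by rw [hi, neg_neg], mul_left_cancel₀ hb0 ?_⟩⟩
    rw [hi]
    linear_combination hbc + h

theorem N_B_generic {t : ℂ} (h4 : t ^ 2 ≠ 4) (h0 : t ≠ 0) (h50 : t ^ 2 ≠ -50) : N (B t) = 3 := by
  choose s hs using fun i => exists_fixedBy_dihedral (root_pow_three i) h4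
  rw [N_B_eq_card (u := fun _ => 0) (v := root) (w := fun i => root i ^ 2) (s := s) ?_ hs ?_ ?_,
    card_rootsOfUnity_three]
  · rfl
  · intro i
    linear_combination root_pow_three i
  · rintro i j (⟨-, h, -⟩ | ⟨-, h, -⟩)
    · exact root_eq_of_eq_or_eq_neg (Or.inl h)
    · exact root_eq_of_eq_or_eq_neg (Or.inr h)
  · intro a b c habc h
    rcases mirror_of_comp_B_eq habc h with ⟨rfl, hc⟩ | ⟨h, -⟩ | ⟨h, -⟩
    · obtain ⟨i, hi⟩ := eq_dihedral (by simpa using habc) hc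
      exact ⟨i, by simpa using hi⟩
    · exact absurd h h0
    · exact absurd h h50

theorem fixedBy_B_zero : FixedBy (B 0) 1 0 0 s(quad 1 0 0 ^ 3, quad 0 0 1 ^ 3) :=
  ⟨1, 0, 0, 0, 0, 1, linearIndependent_quad (Or.inr (by simp)), sum_cubes_eq_B (by simp) (by simp)
    (by simp) (by simp) (by simp) (by simp) (by simp), rfl, by simp, by simp⟩

theorem N_B_zero : N (B 0) = 4 := by
  choose s hs using fun i => exists_fixedBy_dihedral (t := 0) (root_pow_three i) (by norm_num)
  -- The index `none` stands for the extra involution `diag(1, -1)`, which comes from `x ^ 6 + y ^ 6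
  -- = (x ^ 2) ^ 3 + (y ^ 2) ^ 3`.
  rw [N_B_eq_card (ι := Option (rootsOfUnity 3 ℂ)) (u := fun i => i.elim 1 fun _ => 0)
    (v := fun i => i.elim 0 root) (w := fun i => i.elim 0 fun i => root i ^ 2)
    (s := fun i => i.elim s(quad 1 0 0 ^ 3, quad 0 0 1 ^ 3) s) ?_ ?_ ?_ ?_,
    Finite.card_option, card_rootsOfUnity_three]
  · rfl
  · rintro (_ | i)
    · simp
    · have := root_pow_three i
      simp
      linear_combination this
  · rintro (_ | i)
    · exact fixedBy_B_zero
    · exact hs i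
  · rintro (_ | i) (_ | j) h
    · rfl
    · simp at h
    · simp at h
    · simp at h
      rcases h with ⟨h, -⟩ | ⟨h, -⟩
      · exact congrArg some (root_eq_of_eq_or_eq_neg (Or.inl h))
      · exact congrArg some (root_eq_of_eq_or_eq_neg (Or.inr h))
  · intro a b c habc h
    rcases mirror_of_comp_B_eq habc h with ⟨rfl, hc⟩ | ⟨-, rfl, rfl⟩ | ⟨h, -⟩
    · obtain ⟨i, hi⟩ := eq_dihedral (by simpa using habc) hc
      exact ⟨some i, by simpa using hi⟩
    · refine ⟨none, ?_⟩
      rcases eq_or_eq_neg_of_sq_eq_sq a 1 (by simpa using habc) with rfl | rfl <;> simp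
    · norm_num at h

/-- Once `t` and `u` are fixed, `c ^ 3` is determined, which leaves three values of `c`, and `b`
follows from `b * c`. -/
theorem eq_octahedral {t u h b c : ℂ} (hh : h ^ 2 = -1 / 3)
    (htu : t * u * (-h) ^ 3 = 10 / 9) (hbc : b * c = 1 / 3) (htc : t * u * c ^ 3 = 10 / 9) :
    ∃ i, b = h * root i ^ 2 ∧ c = -h * root i := by
  have hh0 : h ≠ 0 := by
    rintro rfl
    norm_num at hh
  have htu0 : t * u ≠ 0 := by
    intro h
    rw [h] at htc
    norm_num at htc
  have hc3 : c ^ 3 = (-h) ^ 3 := mul_left_cancel₀ htu0 (htc.trans htu.symm)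
  have hc0 : c ≠ 0 := by
    rintro rfl
    norm_num at hbc
  obtain ⟨i, hi⟩ := exists_root_eq (k := -c / h) (by
    field_simp
    linear_combination -hc3)
  have hc : c = -h * root i := by
    rw [hi]
    field_simp
  refine ⟨i, mul_right_cancel₀ hc0 ?_, hc⟩
  rw [hbc, hc]
  linear_combination h ^ 2 * root_pow_three i + hh

theorem N_B_octahedral {t : ℂ} (ht : t ^ 2 = -50) : N (B t) = 6 := by
  have ht0 : t ≠ 0 := by
    rintro rfl
    norm_num at ht
  choose s hs using fun i => exists_fixedBy_dihedral (t := t) (root_pow_three i) (by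
    rw [ht]
    norm_num)
  obtain ⟨u, h, hu, hh, hu2, htu, hfix⟩ := exists_fixedBy_octahedral ht
  choose r hr using fun i => hfix (root i) (root_pow_three i)
  have hh0 : h ≠ 0 := by
    rintro rfl
    norm_num at hh
  have huneg : u ≠ -u := by
    intro h
    apply hu
    linear_combination h / 2
  rw [N_B_eq_card (ι := rootsOfUnity 3 ℂ ⊕ rootsOfUnity 3 ℂ)
    (u := Sum.elim (fun _ => 0) (fun _ => u)) (v := Sum.elim root fun i => h * root i ^ 2)
    (w := Sum.elim (fun i => root i ^ 2) fun i => -h * root i) (s := Sum.elim s r) ?_ ?_ ?_ ?_,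
    Nat.card_sum, card_rootsOfUnity_three]
  · rfl
  · rintro (i | i)
    · have := root_pow_three i
      simp
      linear_combination this
    · have := root_pow_three i
      simp
      linear_combination hu2 - h ^ 2 * this - hh
  · rintro (i | i)
    · exact hs i
    · exact hr i
  · rintro (i | i) (j | j) h'
    · simp at h'
      rcases h' with ⟨h', -⟩ | ⟨h', -⟩
      · exact congrArg Sum.inl (root_eq_of_eq_or_eq_neg (Or.inl h'))
      · exact congrArg Sum.inl (root_eq_of_eq_or_eq_neg (Or.inr h'))
    · simp [hu] at h'
    · simp [hu, hu.symm] at h'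
    · rcases h' with ⟨-, -, h'⟩ | ⟨h', -⟩
      · exact congrArg Sum.inr (root_eq_of_eq_or_eq_neg
          (Or.inl (mul_left_cancel₀ (neg_ne_zero.2 hh0) h')))
      · exact absurd h' huneg
  · intro a b c habc hcomp
    rcases mirror_of_comp_B_eq habc hcomp with ⟨rfl, hc⟩ | ⟨h, -⟩ | ⟨-, ha, hc⟩
    · obtain ⟨i, hi⟩ := eq_dihedral (by simpa using habc) hc
      exact ⟨Sum.inl i, by simpa using hi⟩
    · exact absurd h ht0
    · have hbc : b * c = 1 / 3 := by linear_combination habc - ha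
      rcases eq_or_eq_neg_of_sq_eq_sq a u (ha.trans hu2.symm) with rfl | rfl
      · obtain ⟨i, hi⟩ := eq_octahedral hh htu hbc hc
        exact ⟨Sum.inr i, Or.inl ⟨rfl, hi⟩⟩
      · obtain ⟨i, hi, hi'⟩ := eq_octahedral (b := -b) (c := -c) hh htu
          (by linear_combination hbc) (by linear_combination hc)
        refine ⟨Sum.inr i, Or.inr ⟨rfl, ?_, ?_⟩⟩
        · simp only [Sum.elim_inr]
          rw [← hi, neg_neg]
        · simp only [Sum.elim_inr]
          rw [← hi', neg_neg]

theorem N_B_eq_zero {t : ℂ} (ht : t ^ 2 = 4) : N (B t) = 0 := by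
  rw [N, Set.encard_eq_zero, Set.eq_empty_iff_forall_notMem]
  intro s hs
  obtain ⟨u, v, w, hn, hf⟩ := exists_fixedBy (not_hasTripleRoot_B t) hs
  rcases mirror_of_comp_B_eq hn (hf.comp_eq hn) with ⟨rfl, hw⟩ | ⟨rfl, -⟩ | ⟨h, -⟩
  · obtain ⟨a, b, c, a', b', c', hind, hp, -, h1, h2⟩ := hf
    have hvw : v * w = 1 := by simpa using hn
    -- The fixed plane is spanned by `w ^ 2 x ^ 2 + y ^ 2` and `x y`, in which `B t` is a binary
    -- cubic with coefficients `1, 0, -w ^ 2, t`, up to binomial factors.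
    have key : ∀ a b c : ℂ, a * v = b * 0 + c * w →
        quad a b c = c • quad (w ^ 2) 0 1 + b • quad 0 1 0 := by
      intro a b c h
      rw [smul_quad, smul_quad, quad_add_quad]
      congr 1
      · linear_combination w * h - a * hvw
      · ring
      · ring
    rw [key _ _ _ h1, key _ _ _ h2] at hp hind
    have hind' : LinearIndependent ℂ ![quad (w ^ 2) 0 1, quad 0 1 0] :=
      linearIndependent_quad (Or.inl (by
        have : w ≠ 0 := right_ne_zero_of_mul_eq_one hvw
        simpa using this))
    obtain ⟨e0, e1, e2, e3⟩ := sum_cubes_coeffs (a := 1) (b := 0) (c := -w ^ 2) (d := t) hind' (by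
      rw [hp]
      have h6 : (C w : Poly) ^ 6 = 1 := by rw [← C_pow, hw, C_1]
      simp only [quad, B, map_mul, map_neg, map_pow, map_ofNat, map_one, map_zero]
      linear_combination -(X 0 ^ 6) * h6)
    apply pow_ne_zero 6 (det_ne_zero_of_linearIndependent hind)
    -- The discriminant of a sum of two cubes of linear forms is the sixth power of their
    -- determinant. For this cubic it equals `t ^ 2 - 4 w ^ 6 = 0`, against independence.
    have h6 : (c * b' - b * c') ^ 6 =
        ((c ^ 3 + c' ^ 3) * (b ^ 3 + b' ^ 3) -
            (c ^ 2 * b + c' ^ 2 * b') * (c * b ^ 2 + c' * b' ^ 2)) ^ 2 -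
          4 * ((c ^ 3 + c' ^ 3) * (c * b ^ 2 + c' * b' ^ 2) - (c ^ 2 * b + c' ^ 2 * b') ^ 2) *
            ((c ^ 2 * b + c' ^ 2 * b') * (b ^ 3 + b' ^ 3) - (c * b ^ 2 + c' * b' ^ 2) ^ 2) := by
      ring
    rw [h6, e0, e1, e2, e3]
    linear_combination ht - 4 * hw
  · norm_num at ht
  · rw [ht] at h
    norm_num at h

theorem sqrtNegTwo_sq : sqrtNegTwo ^ 2 = -2 := by
  rw [sqrtNegTwo, mul_pow, Complex.I_sq, ← Complex.ofReal_pow, Real.sq_sqrt (by norm_num)]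
  norm_num

end TwoCubes

open TwoCubes in
theorem theorem5p5 :
    (∀ p : TwoCubes.Poly, p.IsHomogeneous 6 →
      (TwoCubes.N p = 3 ↔
        ∃ t : ℂ, t ≠ 2 ∧ t ≠ -2 ∧ t ≠ 0 ∧
          t ≠ 5 * TwoCubes.sqrtNegTwo ∧ t ≠ -(5 * TwoCubes.sqrtNegTwo) ∧
          TwoCubes.Similar p (TwoCubes.B t))) ∧
    TwoCubes.N (TwoCubes.B 2) = 0 ∧
    TwoCubes.N (TwoCubes.B (-2)) = 0 ∧
    TwoCubes.N (TwoCubes.B 0) = 4 ∧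
    TwoCubes.N (TwoCubes.B (5 * TwoCubes.sqrtNegTwo)) = 6 ∧
    TwoCubes.N (TwoCubes.B (-(5 * TwoCubes.sqrtNegTwo))) = 6 := by
  have h2 : N (B 2) = 0 := N_B_eq_zero (by norm_num)
  have h2' : N (B (-2)) = 0 := N_B_eq_zero (by norm_num)
  have h5 : N (B (5 * sqrtNegTwo)) = 6 :=
    N_B_octahedral (by linear_combination 25 * sqrtNegTwo_sq)
  have h5' : N (B (-(5 * sqrtNegTwo))) = 6 :=
    N_B_octahedral (by linear_combination 25 * sqrtNegTwo_sq)
  refine ⟨fun p hp => ⟨fun h => ?_, ?_⟩, h2, h2', N_B_zero, h5, h5'⟩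
  · obtain ⟨s₁, s₂, s₃, h₁₂, h₁₃, h₂₃, hs⟩ := Set.encard_eq_three.1 h
    obtain ⟨t, ht⟩ := exists_similar_B_of_three_representations hp (s₁ := s₁) (s₂ := s₂) (s₃ := s₃)
      (by simp [hs]) (by simp [hs]) (by simp [hs]) h₁₂ h₁₃ h₂₃
    have hN : N (B t) = 3 := ht.N_eq.trans h
    refine ⟨t, ?_, ?_, ?_, ?_, ?_, ht⟩ <;> rintro rfl
    · rw [h2] at hN
      norm_num at hN
    · rw [h2'] at hN
      norm_num at hN
    · rw [N_B_zero] at hN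
      norm_num at hN
    · rw [h5] at hN
      norm_num at hN
    · rw [h5'] at hN
      norm_num at hN
  · rintro ⟨t, h2, h2', h0, h5, h5', ht⟩
    rw [← ht.N_eq]
    refine N_B_generic ?_ h0 ?_
    · intro h
      rcases eq_or_eq_neg_of_sq_eq_sq t 2 (by rw [h]; norm_num) with h | h
      exacts [h2 h, h2' h]
    · intro h
      rcases eq_or_eq_neg_of_sq_eq_sq t (5 * sqrtNegTwo)
        (by linear_combination h - 25 * sqrtNegTwo_sq) with h | h
      exacts [h5 h, h5' h]
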